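/- **Setting.** Let $\mathbb K\in\{\mathbb R,\mathbb C\}$, let $B,\bar B$ be Banach spaces over $\mathbb K$, $k\ge 0$ an integer, and $r,m\in\mathbb N\cup\{\infty\}$ with $m\ge 1$ and $r\ge m+k+2$. Let $G:B\to\bar B$ be of class $C^r$, and let $z:U\to B$ be of class $C^r$ on an open neighbourhood $U$ of $0\in\mathbb K$ with $z(0)=0$ (derivatives are taken over $\mathbb K$, so for $\mathbb K=\mathbb C$ the maps are holomorphic). Put $L(\varepsilon)=G'[z(\varepsilon)]$. All $O(\cdot)$ are for $\varepsilon\to0$, and "curve" means a polynomial $b(\varepsilon)=b_0+\varepsilon b_1+\dots+\varepsilon^k b_k$ in $B$ with root element $b_0$. *$k$-surjectivity.* For every $\bar b\in\bar B$ there is a curve $b(\varepsilon)$ with $L(\varepsilon)b(\varepsilon)=\varepsilon^k\bar b+O(\varepsilon^{k+1})$. *Direct sums.* There are given closed subspaces with $$B=N_1^c\oplus\dots\oplus N_{k+1}^c\oplus N_{k+1},\qquad \bar B=R_1\oplus\dots\oplus R_{k+1}$$ built along the Jordan chains of $L$: for $0\le j\le k+1$ the subspace $N_{j+1}^c\oplus\dots\oplus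 N_{k+1}^c\oplus N_{k+1}$ consists of the $b_0\in B$ that are root elements of a curve with $L(\varepsilon)b(\varepsilon)=O(\varepsilon^j)$, and for $0\le j<k$ the subspace $R_1\oplus\dots\oplus R_{j+1}$ consists of the $\bar b\in\bar B$ for which some curve satisfies $L(\varepsilon)b(\varepsilon)=\varepsilon^j\bar b+O(\varepsilon^{j+1})$. Write $N^c=N_1^c\times\dots\times N_{k+1}^c$, and equip $N^c$ and $N^c\times N_{k+1}$ with the maximum norm. *Jordan chain data.* This means isomorphisms $S_i\in GL[N_i^c,R_i]$, $i=1,\dots,k+1$, and a polynomial $p_k(\varepsilon)=I_B+\varepsilon\phi_1+\dots+\varepsilon^k\phi_k$ with bounded linear $\phi_i:B\to N_1^c\oplus\dots\oplus N_{k+1-i}^c$ such that $$L(\varepsilon)p_k(\varepsilon)n_{i+1}^c=\varepsilon^iS_{i+1}n_{i+1}^c+O(\varepsilon^{i+1})\ (n_{i+1}^c\in N_{i+1}^c,\ 0\le i\le k),\qquad L(\varepsilon)p_k(\varepsilon)n_{k+1}=O(\varepsilon^{k+1})\ (n_{k+1}\in N_{k+1}).$$ Put $(S_1\cdots S_{k+1})\varphi=S_1\varphi_1+\dots+S_{k+1}\varphi_{k+1}$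 for $\varphi\in N^c$. **Theorem (Linearization Theorem).** Let $L$ be $k$-surjective with direct sums as above. Then Jordan chain data exist. For all Jordan chain data there are $\delta,\rho>0$ with $\{|\varepsilon|<\delta\}\subset U$ and a map $\psi^c=(\psi_1^c,\dots,\psi_{k+1}^c)(\varepsilon,\varphi,n_{k+1})\in N^c$ of class $C^m$ on $\{|\varepsilon|<\delta\}\times V$, where $V=\{(\varphi,n_{k+1})\in N^c\times N_{k+1}:\|(\varphi,n_{k+1})\|<\rho\}$, such that with $$\Psi^c=\varepsilon^k\psi_1^c+\dots+\varepsilon\,\psi_k^c+\psi_{k+1}^c$$ the following holds. (i) For $|\varepsilon|<\delta$ and $(\varphi,n_{k+1})\in V$ one has $\psi^c(\varepsilon,0,0)=0$ and $$G\big[z(\varepsilon)+\varepsilon^kp_k(\varepsilon)\{\Psi^c(\varepsilon,\varphi,n_{k+1})+n_{k+1}\}\big]=G[z(\varepsilon)]+\varepsilon^{2k}(S_1\cdots S_{k+1})\varphi .$$ At $\varepsilon=0$ the map is near the identity: for $i=1,\dots,k+1$, $$\psi_i^c(0,\varphi,n_{k+1})=\varphi_i+\chi_i^c(n_{k+1},\varphi_{k+1})\cdot\binom{n_{k+1}}{\varphi_{k+1}}^2$$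 with $C^m$ maps $\chi_i^c$, defined for $\|(n_{k+1},\varphi_{k+1})\|<\rho$, whose values are bounded bilinear maps $X\times X\to N_i^c$ on $X=N_{k+1}\times N_{k+1}^c$ (the exponent $2$ means that both arguments are equal). (ii) For every fixed $\varepsilon\ne0$ with $|\varepsilon|<\delta$ the map $$(\varphi,n_{k+1})\mapsto z(\varepsilon)+\varepsilon^kp_k(\varepsilon)\{\Psi^c(\varepsilon,\varphi,n_{k+1})+n_{k+1}\}$$ is a $C^m$ diffeomorphism from $V$ (which does not depend on $\varepsilon$) onto an open neighbourhood $W_\varepsilon$ of $z(\varepsilon)$ in $B$. For every $\varphi$ with $\|\varphi\|<\rho$, the level set $\{b\in W_\varepsilon: G[b]=G[z(\varepsilon)]+\varepsilon^{2k}(S_1\cdots S_{k+1})\varphi\}$ is $$\{z(\varepsilon)+\varepsilon^kp_k(\varepsilon)\{\Psi^c(\varepsilon,\varphi,n_{k+1})+n_{k+1}\}:\ n_{k+1}\in N_{k+1},\ \|n_{k+1}\|<\rho\}.$$ -/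

import Mathlib

open Filter Topology Metric Asymptotics

section LinearizationDefs

variable {𝕜 : Type*} [RCLike 𝕜]
  {B : Type*} [NormedAddCommGroup B] [NormedSpace 𝕜 B]
  {B' : Type*} [NormedAddCommGroup B'] [NormedSpace 𝕜 B']

/-- The polynomial curve `b₀ + ε b₁ + ⋯ + εᵏ bₖ`. It is used for curves of vectors and for
polynomial families of bounded operators. -/
noncomputable def polyCurve {E : Type*} [NormedAddCommGroup E] [NormedSpace 𝕜 E] {k : ℕ}
    (b : Fin (k + 1) → E) (ε : 𝕜) : E :=
  ∑ i : Fin (k + 1), ε ^ (i : ℕ) • b i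

/-- The family `L` is `k`-surjective: every `b'` in the image space is the leading coefficient
of order `k` of some curve `b₀ + ⋯ + εᵏ bₖ`, i.e. `L(ε) b(ε) = εᵏ b' + O(εᵏ⁺¹)`. -/
def IsKSurjective (L : 𝕜 → B →L[𝕜] B') (k : ℕ) : Prop :=
  ∀ b' : B', ∃ b : Fin (k + 1) → B,
    (fun ε : 𝕜 => L ε (polyCurve b ε) - ε ^ k • b') =O[𝓝 0] fun ε : 𝕜 => ε ^ (k + 1)

/-- The elements of rank at least `j`: root elements `b₀` of curves `b₀ + ⋯ + εᵏ bₖ` that are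
approximations of order `j`, i.e. `L(ε) b(ε) = O(εʲ)`. Only `j ≤ k + 1` is used, and then
coefficients of degree larger than `k` would play no role. -/
def rankAtLeast (L : 𝕜 → B →L[𝕜] B') (k j : ℕ) : Set B :=
  {b₀ | ∃ b : Fin (k + 1) → B, b 0 = b₀ ∧
    (fun ε : 𝕜 => L ε (polyCurve b ε)) =O[𝓝 0] fun ε : 𝕜 => ε ^ j}

/-- The leading coefficients of order `j`: all `b'` with `L(ε) b(ε) = εʲ b' + O(εʲ⁺¹)` for some
curve `b₀ + ⋯ + εᵏ bₖ`. Only `j ≤ k` is used. -/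
def leadingCoeffs (L : 𝕜 → B →L[𝕜] B') (k j : ℕ) : Set B' :=
  {b' | ∃ b : Fin (k + 1) → B,
    (fun ε : 𝕜 => L ε (polyCurve b ε) - ε ^ j • b') =O[𝓝 0] fun ε : 𝕜 => ε ^ (j + 1)}

/-- The sum operator `M₁ × ⋯ × Mₖ₊₁ → E`. -/
noncomputable def familySum {E : Type*} [NormedAddCommGroup E] [NormedSpace 𝕜 E] {k : ℕ}
    (M : Fin (k + 1) → Submodule 𝕜 E) (x : ∀ i, M i) : E :=
  ∑ i, (x i : E)

/-- The scaled sum `εᵏ x₁ + ⋯ + ε xₖ + xₖ₊₁`. -/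
noncomputable def scaledSum {E : Type*} [NormedAddCommGroup E] [NormedSpace 𝕜 E] {k : ℕ}
    (M : Fin (k + 1) → Submodule 𝕜 E) (ε : 𝕜) (x : ∀ i, M i) : E :=
  ∑ i : Fin (k + 1), ε ^ (k - (i : ℕ)) • (x i : E)

/-- Closed direct sums `B = N₁ᶜ ⊕ ⋯ ⊕ Nₖ₊₁ᶜ ⊕ Nₖ₊₁` and `B' = R₁ ⊕ ⋯ ⊕ Rₖ₊₁` along the Jordan
chains of `L` (indices are shifted by one: `Nc i` is `N_{i+1}ᶜ`, `R i` is `R_{i+1}`).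
`N_{j+1}ᶜ ⊕ ⋯ ⊕ Nₖ₊₁ᶜ ⊕ Nₖ₊₁` is the set of elements of rank at least `j` for `j ≤ k + 1`, and
`R₁ ⊕ ⋯ ⊕ R_{j+1}` is the set of leading coefficients of order `j` for `j < k`
(for `j = k` this would say that `L` is `k`-surjective). -/
structure IsJordanDecomposition (L : 𝕜 → B →L[𝕜] B') (k : ℕ)
    (Nc : Fin (k + 1) → Submodule 𝕜 B) (N : Submodule 𝕜 B)
    (R : Fin (k + 1) → Submodule 𝕜 B') : Prop where
  isClosed_Nc : ∀ i, IsClosed (Nc i : Set B)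
  isClosed_N : IsClosed (N : Set B)
  isClosed_R : ∀ i, IsClosed (R i : Set B')
  direct_domain : Function.Bijective fun x : (∀ i, Nc i) × N => familySum Nc x.1 + (x.2 : B)
  direct_image : Function.Bijective fun y : ∀ i, R i => familySum R y
  rank_iff : ∀ j ≤ k + 1, ∀ (x : ∀ i, Nc i) (n : N),
    familySum Nc x + (n : B) ∈ rankAtLeast L k j ↔ ∀ i : Fin (k + 1), (i : ℕ) < j → x i = 0
  leading_iff : ∀ j < k, ∀ y : ∀ i, R i,
    familySum R y ∈ leadingCoeffs L k j ↔ ∀ i : Fin (k + 1), j < (i : ℕ) → y i = 0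

/-- The operators `S i ∈ GL[Nc i, R i]` and the polynomial `p(ε) = I + ε p₁ + ⋯ + εᵏ pₖ` describe
the Jordan chains of `L`: `p i` maps into `N₁ᶜ ⊕ ⋯ ⊕ N_{k+1-i}ᶜ` for `i ≥ 1`,
`L(ε) p(ε) x = εⁱ S_{i+1} x + O(εⁱ⁺¹)` on `N_{i+1}ᶜ`, and `L(ε) p(ε) n = O(εᵏ⁺¹)` on `Nₖ₊₁`. -/
structure IsJordanPolynomial (L : 𝕜 → B →L[𝕜] B') {k : ℕ}
    (Nc : Fin (k + 1) → Submodule 𝕜 B) (N : Submodule 𝕜 B)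
    (R : Fin (k + 1) → Submodule 𝕜 B')
    (S : ∀ i, Nc i ≃L[𝕜] R i) (p : Fin (k + 1) → B →L[𝕜] B) : Prop where
  coeff_zero : p 0 = ContinuousLinearMap.id 𝕜 B
  coeff_range : ∀ i : Fin (k + 1), i ≠ 0 → ∀ b : B,
    ∃ x : ∀ j, Nc j, (∀ j : Fin (k + 1), k < (i : ℕ) + (j : ℕ) → x j = 0) ∧
      p i b = familySum Nc x
  chain_Nc : ∀ (i : Fin (k + 1)) (x : Nc i),
    (fun ε : 𝕜 => L ε (polyCurve p ε (x : B)) - ε ^ (i : ℕ) • (S i x : B'))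
      =O[𝓝 0] fun ε : 𝕜 => ε ^ ((i : ℕ) + 1)
  chain_N : ∀ n : N,
    (fun ε : 𝕜 => L ε (polyCurve p ε (n : B))) =O[𝓝 0] fun ε : 𝕜 => ε ^ (k + 1)

/-- The operator `(S₁ ⋯ Sₖ₊₁) φ = S₁ φ₁ + ⋯ + Sₖ₊₁ φₖ₊₁`. -/
noncomputable def opSum {k : ℕ} {Nc : Fin (k + 1) → Submodule 𝕜 B} {R : Fin (k + 1) → Submodule 𝕜 B'}
    (S : ∀ i, Nc i ≃L[𝕜] R i) (φ : ∀ i, Nc i) : B' :=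
  ∑ i, (S i (φ i) : B')

/-- The blow up map `(φ, n) ↦ z(ε) + εᵏ p(ε) {Ψᶜ(ε, φ, n) + n}` for the value `ε`, with
`Ψᶜ = εᵏ ψ₁ + ⋯ + ε ψₖ + ψₖ₊₁`. -/
noncomputable def coneMap {k : ℕ} {Nc : Fin (k + 1) → Submodule 𝕜 B} {N : Submodule 𝕜 B}
    (z : 𝕜 → B) (p : Fin (k + 1) → B →L[𝕜] B)
    (ψ : 𝕜 × ((∀ i, Nc i) × N) → ∀ i, Nc i) (ε : 𝕜) (x : (∀ i, Nc i) × N) : B :=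
  z ε + ε ^ k • polyCurve p ε (scaledSum Nc ε (ψ (ε, x)) + (x.2 : B))

end LinearizationDefs

-- The curve `p(ε)x` with `x` in the `i`-th complement is mapped by `L(ε)` to order `ε^(i-1)`.
-- Giving `x_i` the weight `ε^(k+1-i)` levels out these orders: `L(ε)` maps `p(ε){ε^k x_1 + ⋯ +
-- x_{k+1} + n}` to `ε^k (S_1 x_1 + ⋯ + S_{k+1} x_{k+1} + O(ε))`. With the outer factor `ε^k`, the
-- linear part of the increment of `G` at `z(ε)` has order `ε^(2k)`, which is also the order of the
-- quadratic Taylor remainder. Division by `ε^(2k)` therefore leaves a map of class `C^m` across `ε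
-- = 0`. In the coordinates of `S_1 ⋯ S_{k+1}` it is `h(ε, x, n)`, with `h(ε, 0, 0) = 0` and
-- derivative `(ε, x, n) ↦ x` at the origin (`IsJordanPolynomial.exists_blowup`).
--
-- Hence `(ε, x, n) ↦ (ε, h, n)` has the identity as derivative at the origin, and its local inverse
-- supplies `ψ` with `h(ε, ψ, n) = φ` (`ContDiffOn.exists_openPartialHomeomorph`). The inversion
-- takes place in all variables including `ε`, so one ball `V` serves all small `ε`. For `ε ≠ 0` the
-- rescaling is a linear isomorphism, and the diffeomorphism and its level sets are carried over to
-- `B`. At `ε = 0` the quadratic term sees only `η = x_{k+1} + n`, so `η` solves an equation of its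
-- own, from which the quadratic forms `χ` are obtained (`exists_quadratic_form_of_perturbed_eq`).
--
-- Existence of the chain data is algebra on Taylor coefficients: the chains are corrected order by
-- order by shifted earlier chains until each leading coefficient lies in its own `R_i`
-- (`IsPartialJordanSeries.step`). Smoothness of all quotients rests on Hadamard's lemma
-- (`exists_contDiffOn_increment_factor`).

universe u v

/-! ### Smooth dependence of integrals along segments -/

section SegmentIntegral

/-- Supplies the constant dominating function for integrals depending on a parameter; the tube
argument needs continuity only at the points over `x₀`. -/
theorem eventually_norm_le_of_continuousAt {X F : Type*} [TopologicalSpace X] [NormedAddCommGroup F]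
    {K : Set ℝ} (hK : IsCompact K) (h : X × ℝ → F) (x₀ : X)
    (hc : ∀ t ∈ K, ContinuousAt h (x₀, t)) :
    ∃ C, ∀ᶠ x in 𝓝 x₀, ∀ t ∈ K, ‖h (x, t)‖ ≤ C := by
  have h1 : ContinuousOn (fun t => ‖h (x₀, t)‖) K := fun t ht =>
    ((hc t ht).comp (f := fun t => (x₀, t))
      (by fun_prop)).norm.continuousWithinAt
  obtain ⟨C, hC⟩ := hK.bddAbove_image h1
  refine ⟨C + 1, hK.eventually_forall_of_forall_eventually fun t ht => ?_⟩
  have h2 : ‖h (x₀, t)‖ < C + 1 := by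
    have := hC ⟨t, ht, rfl⟩
    simp only at this
    linarith
  exact ((hc t ht).norm.eventually_lt continuousAt_const h2).mono fun x hx => hx.le

variable {𝕜 : Type*} [RCLike 𝕜]

/-- Differentiation under the integral, by induction on `n`. The derivative replaces `g` by `fderiv
𝕜 g` and, in the direction variable, brings down a factor `t`; the induction therefore runs over all
weights `w` and all targets `F`. The universe of `F` is chosen so that `E →L[𝕜] F` lies in it too.
-/
theorem contDiffOn_segment_integral_aux {E : Type u} [NormedAddCommGroup E] [NormedSpace 𝕜 E]
    {s : Set E} (hs : IsOpen s) {P : Set (E × E)} (hP : IsOpen P)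
    (hPs : ∀ x ∈ P, ∀ t ∈ Set.Icc (0 : ℝ) 1, x.1 + (t : 𝕜) • x.2 ∈ s) (n : ℕ) :
    ∀ {F : Type (max u v)} [NormedAddCommGroup F] [NormedSpace 𝕜 F] [NormedSpace ℝ F]
      [IsScalarTower ℝ 𝕜 F] [CompleteSpace F] {g : E → F}, ContDiffOn 𝕜 n g s →
      ∀ {w : ℝ → 𝕜}, Continuous w →
      ContDiffOn 𝕜 n (fun x : E × E => ∫ t in (0 : ℝ)..1, w t • g (x.1 + (t : 𝕜) • x.2)) P := by
  have hsub : Set.uIoc (0 : ℝ) 1 ⊆ Set.Icc 0 1 := by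
    rw [Set.uIoc_of_le zero_le_one]; exact Set.Ioc_subset_Icc_self
  have key : ∀ {F : Type (max u v)} [NormedAddCommGroup F] [NormedSpace 𝕜 F] {g : E → F}
      (_ : ContinuousOn g s) {w : ℝ → 𝕜} (_ : Continuous w) (x : E × E) (_ : x ∈ P) (t : ℝ)
      (_ : t ∈ Set.Icc (0 : ℝ) 1),
      ContinuousAt (fun y : (E × E) × ℝ => w y.2 • g (y.1.1 + (y.2 : 𝕜) • y.1.2)) (x, t) := by
    intro F _ _ g hg w hw x hx t ht
    refine (hw.comp continuous_snd).continuousAt.smul ?_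
    refine ContinuousAt.comp (g := g) (f := fun y : (E × E) × ℝ => y.1.1 + (y.2 : 𝕜) • y.1.2)
      (hg.continuousAt (hs.mem_nhds (hPs x hx t ht))) ?_
    have : Continuous fun y : (E × E) × ℝ => y.1.1 + (y.2 : 𝕜) • y.1.2 := by
      have := (RCLike.continuous_ofReal (K := 𝕜))
      fun_prop
    exact this.continuousAt
  have key2 : ∀ {F : Type (max u v)} [NormedAddCommGroup F] [NormedSpace 𝕜 F] {g : E → F}
      (_ : ContinuousOn g s) {w : ℝ → 𝕜} (_ : Continuous w) (x : E × E) (_ : x ∈ P),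
      ContinuousOn (fun t : ℝ => w t • g (x.1 + (t : 𝕜) • x.2)) (Set.Icc 0 1) := by
    intro F _ _ g hg w hw x hx t ht
    exact ((key hg hw x hx t ht).comp (f := fun t => (x, t)) (by fun_prop)).continuousWithinAt
  have meas : ∀ {F : Type (max u v)} [NormedAddCommGroup F] [NormedSpace 𝕜 F] {g : E → F}
      (_ : ContinuousOn g s) {w : ℝ → 𝕜} (_ : Continuous w) (x : E × E) (_ : x ∈ P),
      MeasureTheory.AEStronglyMeasurable (fun t : ℝ => w t • g (x.1 + (t : 𝕜) • x.2))
        (MeasureTheory.volume.restrict (Set.uIoc 0 1)) := by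
    intro F _ _ g hg w hw x hx
    exact ((key2 hg hw x hx).mono hsub).aestronglyMeasurable measurableSet_uIoc
  have intg : ∀ {F : Type (max u v)} [NormedAddCommGroup F] [NormedSpace 𝕜 F] {g : E → F}
      (_ : ContinuousOn g s) {w : ℝ → 𝕜} (_ : Continuous w) (x : E × E) (_ : x ∈ P),
      IntervalIntegrable (fun t : ℝ => w t • g (x.1 + (t : 𝕜) • x.2)) MeasureTheory.volume 0 1 := by
    intro F _ _ g hg w hw x hx
    exact ContinuousOn.intervalIntegrable_of_Icc zero_le_one (key2 hg hw x hx)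
  induction n with
  | zero =>
    intro F _ _ _ _ _ g hg w hw
    simp only [Nat.cast_zero, contDiffOn_zero] at hg ⊢
    intro x hx
    refine ContinuousAt.continuousWithinAt ?_
    obtain ⟨C, hC⟩ := eventually_norm_le_of_continuousAt isCompact_Icc _ x (key hg hw x hx)
    refine intervalIntegral.continuousAt_of_dominated_interval (bound := fun _ => C) ?_ ?_ ?_ ?_
    · filter_upwards [hP.mem_nhds hx] with y hy using meas hg hw y hy
    · filter_upwards [hC] with y hy using Eventually.of_forall fun t ht => hy t (hsub ht)
    · simp
    · exact Eventually.of_forall fun t ht =>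
        (key hg hw x hx t (hsub ht)).comp (f := fun y => (y, t)) (by fun_prop)
  | succ n ih =>
    intro F _ _ _ _ _ g hg w hw
    push_cast at hg ⊢
    have hg' : ContDiffOn 𝕜 n (fderiv 𝕜 g) s := hg.fderiv_of_isOpen hs le_rfl
    have hgd : ∀ x ∈ s, HasFDerivAt g (fderiv 𝕜 g x) x := fun x hx =>
      ((hg.differentiableOn (by simp)).differentiableAt (hs.mem_nhds hx)).hasFDerivAt
    have hw2 : Continuous fun t : ℝ => w t * (t : 𝕜) := hw.mul RCLike.continuous_ofReal
    have I1 := ih hg' hw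
    have I2 := ih hg' hw2
    rw [contDiffOn_succ_iff_hasFDerivWithinAt_of_uniqueDiffOn hP.uniqueDiffOn]
    let cf : (E →L[𝕜] F) →L[𝕜] (E × E →L[𝕜] F) :=
      (ContinuousLinearMap.compL 𝕜 (E × E) E F).flip (ContinuousLinearMap.fst 𝕜 E E)
    let cs : (E →L[𝕜] F) →L[𝕜] (E × E →L[𝕜] F) :=
      (ContinuousLinearMap.compL 𝕜 (E × E) E F).flip (ContinuousLinearMap.snd 𝕜 E E)
    refine ⟨by simp, fun x => cf (∫ t in (0 : ℝ)..1, w t • fderiv 𝕜 g (x.1 + (t : 𝕜) • x.2)) +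
      cs (∫ t in (0 : ℝ)..1, (w t * (t : 𝕜)) • fderiv 𝕜 g (x.1 + (t : 𝕜) • x.2)),
      (cf.contDiff.comp_contDiffOn I1).add (cs.contDiff.comp_contDiffOn I2), ?_⟩
    intro x hx
    refine HasFDerivAt.hasFDerivWithinAt ?_
    let F' : E × E → ℝ → (E × E →L[𝕜] F) := fun x t =>
      cf (w t • fderiv 𝕜 g (x.1 + (t : 𝕜) • x.2)) +
        cs ((w t * (t : 𝕜)) • fderiv 𝕜 g (x.1 + (t : 𝕜) • x.2))
    have hF'c : ∀ t ∈ Set.Icc (0 : ℝ) 1, ContinuousAt (fun y : (E × E) × ℝ => F' y.1 y.2) (x, t) := by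
      intro t ht
      exact (cf.continuous.continuousAt.comp (key hg'.continuousOn hw x hx t ht)).add
        (cs.continuous.continuousAt.comp (key hg'.continuousOn hw2 x hx t ht))
    obtain ⟨C, hC⟩ := eventually_norm_le_of_continuousAt isCompact_Icc _ x hF'c
    have hmem : {y | ∀ t ∈ Set.Icc (0 : ℝ) 1, ‖F' y t‖ ≤ C} ∩ P ∈ 𝓝 x :=
      inter_mem hC (hP.mem_nhds hx)
    have main := intervalIntegral.hasFDerivAt_integral_of_dominated_of_fderiv_le (𝕜 := 𝕜)
      (F := fun (x : E × E) t => w t • g (x.1 + (t : 𝕜) • x.2)) (F' := F') (x₀ := x)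
      (μ := MeasureTheory.volume) (a := 0) (b := 1) (bound := fun _ => C) hmem
      (by filter_upwards [hP.mem_nhds hx] with y hy using meas hg.continuousOn hw y hy)
      (intg hg.continuousOn hw x hx)
      ((cf.continuous.comp_aestronglyMeasurable (meas hg'.continuousOn hw x hx)).add
        (cs.continuous.comp_aestronglyMeasurable (meas hg'.continuousOn hw2 x hx)))
      (Eventually.of_forall fun t ht y hy => hy.1 t (hsub ht)) (by simp)
      (Eventually.of_forall fun t ht y hy => by
        have h1 : HasFDerivAt (fun y : E × E => y.1 + (t : 𝕜) • y.2)
            (ContinuousLinearMap.fst 𝕜 E E + (t : 𝕜) • ContinuousLinearMap.snd 𝕜 E E) y :=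
          hasFDerivAt_fst.add (hasFDerivAt_snd.const_smul _)
        have h2 := ((hgd _ (hPs y hy.2 t (hsub ht))).comp y h1).const_smul (w t)
        convert! h2 using 1
        ext v <;> simp [F', cf, cs, mul_smul])
    convert! main using 1
    have e1 := intg hg'.continuousOn hw x hx
    have e2 := intg hg'.continuousOn hw2 x hx
    simp only [F']
    rw [intervalIntegral.integral_add, cf.intervalIntegral_comp_comm e1,
      cs.intervalIntegral_comp_comm e2]
    · exact ⟨cf.integrable_comp e1.1, cf.integrable_comp e1.2⟩
    · exact ⟨cs.integrable_comp e2.1, cs.integrable_comp e2.2⟩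

end SegmentIntegral

/-! ### Hadamard's lemma and Taylor formulas with smooth remainder factors -/

section SmoothDivision

variable {𝕜 : Type*} [RCLike 𝕜]

/-- Hadamard's lemma: increments of a `Cⁿ⁺¹` map along segments factor through a `Cⁿ` operator. -/
theorem exists_contDiffOn_increment_factor {E F : Type*} [NormedAddCommGroup E] [NormedSpace 𝕜 E]
    [NormedAddCommGroup F] [NormedSpace 𝕜 F] [CompleteSpace F]
    {s : Set E} (hs : IsOpen s) {P : Set (E × E)} (hP : IsOpen P)
    (hPs : ∀ x ∈ P, ∀ t ∈ Set.Icc (0 : ℝ) 1, x.1 + (t : 𝕜) • x.2 ∈ s) {n : ℕ∞} {f : E → F}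
    (hf : ContDiffOn 𝕜 (n + 1) f s) :
    ∃ K : E × E → E →L[𝕜] F, ContDiffOn 𝕜 n K P ∧
      (∀ x ∈ P, f (x.1 + x.2) - f x.1 = K x x.2) ∧ ∀ a, K (a, 0) = fderiv 𝕜 f a := by
  let _ : NormedSpace ℝ F := NormedSpace.restrictScalars ℝ 𝕜 F
  have _ : IsScalarTower ℝ 𝕜 F := ⟨fun x y z => by
    rw [Algebra.smul_def, mul_smul]; rfl⟩
  have hf' : ContDiffOn 𝕜 n (fderiv 𝕜 f) s := hf.fderiv_of_isOpen hs le_rfl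
  have hd : ∀ x ∈ s, HasFDerivAt f (fderiv 𝕜 f x) x := fun x hx =>
    ((hf.differentiableOn (by simp)).differentiableAt (hs.mem_nhds hx)).hasFDerivAt
  refine ⟨fun x => ∫ t in (0 : ℝ)..1, (1 : 𝕜) • fderiv 𝕜 f (x.1 + (t : 𝕜) • x.2), ?_, ?_, ?_⟩
  · rw [contDiffOn_iff_forall_nat_le]
    intro j hj
    exact contDiffOn_segment_integral_aux hs hP hPs j
      (hf'.of_le (by exact_mod_cast hj)) continuous_const
  · intro x hx
    have hc : ContinuousOn (fun t : ℝ => (1 : 𝕜) • fderiv 𝕜 f (x.1 + (t : 𝕜) • x.2))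
        (Set.Icc 0 1) := by
      simp only [one_smul]
      refine ContinuousOn.comp (g := fderiv 𝕜 f) (f := fun t : ℝ => x.1 + (t : 𝕜) • x.2) (t := s)
        hf'.continuousOn ?_ (fun t ht => hPs x hx t ht)
      have := (RCLike.continuous_ofReal (K := 𝕜))
      fun_prop
    have hi : IntervalIntegrable (fun t : ℝ => (1 : 𝕜) • fderiv 𝕜 f (x.1 + (t : 𝕜) • x.2))
        MeasureTheory.volume 0 1 :=
      ContinuousOn.intervalIntegrable_of_Icc zero_le_one hc
    rw [← ContinuousLinearMap.apply_apply (𝕜 := 𝕜) x.2, ← ContinuousLinearMap.intervalIntegral_comp_comm _ hi]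
    have hder : ∀ t ∈ Set.uIcc (0 : ℝ) 1, HasDerivAt (fun t : ℝ => f (x.1 + (t : 𝕜) • x.2))
        ((ContinuousLinearMap.apply 𝕜 F x.2) ((1 : 𝕜) • fderiv 𝕜 f (x.1 + (t : 𝕜) • x.2))) t := by
      intro t ht
      rw [Set.uIcc_of_le zero_le_one] at ht
      have h1 : HasDerivAt (fun c : 𝕜 => x.1 + c • x.2) x.2 (t : 𝕜) := by
        simpa using ((hasDerivAt_id (t : 𝕜)).smul_const x.2).const_add x.1
      have h2 := (hd _ (hPs x hx t ht)).comp_hasDerivAt (t : 𝕜) h1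
      have h3 : HasDerivAt (fun t : ℝ => (t : 𝕜)) 1 t := by
        simpa using (RCLike.ofRealCLM (K := 𝕜)).hasDerivAt (x := t)
      have h4 := h2.scomp t h3
      simp only [one_smul] at h4 ⊢
      exact h4
    rw [intervalIntegral.integral_eq_sub_of_hasDerivAt hder]
    · simp
    · refine ContinuousOn.intervalIntegrable_of_Icc zero_le_one ?_
      exact (ContinuousLinearMap.apply 𝕜 F x.2).continuous.comp_continuousOn hc
  · intro a
    simp

/-- The second order Taylor formula with a smooth remainder form. -/
theorem exists_contDiff_quadratic_remainder {E F : Type*} [NormedAddCommGroup E] [NormedSpace 𝕜 E]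
    [NormedAddCommGroup F] [NormedSpace 𝕜 F] [CompleteSpace F] {n : ℕ∞} {f : E → F}
    (hf : ContDiff 𝕜 (n + 2) f) :
    ∃ Q : E × E → E →L[𝕜] E →L[𝕜] F, ContDiff 𝕜 n Q ∧
      ∀ a y, f (a + y) = f a + fderiv 𝕜 f a y + Q (a, y) y y := by
  have hf1 : ContDiffOn 𝕜 ((n + 1 : ℕ∞) + 1) f Set.univ := by
    refine (hf.of_le ?_).contDiffOn
    push_cast
    rw [add_assoc, one_add_one_eq_two]
  obtain ⟨K, hK, hKf, hK0⟩ := exists_contDiffOn_increment_factor isOpen_univ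
    (P := Set.univ) isOpen_univ (by simp) hf1
  obtain ⟨K₂, hK₂, hK₂f, -⟩ := exists_contDiffOn_increment_factor isOpen_univ
    (P := Set.univ) isOpen_univ (by simp) (n := n) (by exact_mod_cast hK)
  rw [contDiffOn_univ] at hK₂
  -- Hadamard's lemma is applied twice: `K (a, y) - K (a, 0)` is an increment of `K` in the
  -- direction `(0, y)`, and `K (a, 0)` is the derivative at `a`.
  refine ⟨fun x => (K₂ ((x.1, 0), (0, x.2))).comp (ContinuousLinearMap.inr 𝕜 E E), ?_, ?_⟩
  · have : ContDiff 𝕜 n fun x : E × E => K₂ ((x.1, 0), (0, x.2)) := hK₂.comp (by fun_prop)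
    exact this.clm_comp contDiff_const
  · intro a y
    have h1 := hKf (a, y) trivial
    have h2 := hK₂f ((a, 0), (0, y)) trivial
    simp only [Prod.mk_add_mk, add_zero, zero_add] at h1 h2
    simp only [ContinuousLinearMap.comp_apply, ContinuousLinearMap.inr_apply, ← h2, hK0,
      sub_apply, ← h1]
    abel

theorem exists_contDiffOn_taylor_one {F : Type*} [NormedAddCommGroup F] [NormedSpace 𝕜 F]
    [CompleteSpace F] {n : ℕ∞} {δ : ℝ} {f : 𝕜 → F} (hf : ContDiffOn 𝕜 (n + 1) f (ball 0 δ)) :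
    ∃ g : 𝕜 → F, ContDiffOn 𝕜 n g (ball 0 δ) ∧ ∀ ε ∈ ball (0 : 𝕜) δ, f ε = f 0 + ε • g ε := by
  obtain ⟨K, hK, hKf, -⟩ := exists_contDiffOn_increment_factor (𝕜 := 𝕜) isOpen_ball
    -- An open set of pairs whose segments stay in the ball and which contains every `(0, ε)` with
    -- `‖ε‖ < δ`.
    (P := {x : 𝕜 × 𝕜 | ‖x.1‖ + ‖x.2‖ < δ})
    (isOpen_lt (by fun_prop) continuous_const) (by
      intro x hx t ht
      rw [mem_ball_zero_iff]
      refine lt_of_le_of_lt ((norm_add_le _ _).trans ?_) hx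
      gcongr
      rw [norm_smul, RCLike.norm_ofReal, abs_of_nonneg ht.1]
      exact mul_le_of_le_one_left (norm_nonneg _) ht.2) hf
  refine ⟨fun ε => K (0, ε) 1, ?_, ?_⟩
  · refine ContDiffOn.clm_apply (hK.comp (f := fun ε : 𝕜 => ((0 : 𝕜), ε)) (by fun_prop) ?_)
      contDiffOn_const
    intro ε hε
    simpa using hε
  · intro ε hε
    have := hKf (0, ε) (by simpa using hε)
    simp only [zero_add] at this
    rw [← map_smul, smul_eq_mul, mul_one, ← this]
    abel

/-- Taylor expansion of a function of one scalar variable, with a smooth remainder factor. -/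
theorem exists_contDiffOn_taylor {F : Type*} [NormedAddCommGroup F] [NormedSpace 𝕜 F]
    [CompleteSpace F] {n : ℕ∞} {δ : ℝ} (K : ℕ) {f : 𝕜 → F}
    (hf : ContDiffOn 𝕜 (n + K) f (ball 0 δ)) :
    ∃ (c : ℕ → F) (g : 𝕜 → F), ContDiffOn 𝕜 n g (ball 0 δ) ∧
      ∀ ε ∈ ball (0 : 𝕜) δ, f ε = ∑ l ∈ Finset.range K, ε ^ l • c l + ε ^ K • g ε := by
  induction K generalizing f with
  | zero => exact ⟨0, f, by simpa using hf, by simp⟩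
  | succ K ih =>
    obtain ⟨g₁, hg₁, hfg⟩ := exists_contDiffOn_taylor_one (n := n + K) (f := f) (by
      push_cast at hf ⊢; rwa [add_assoc])
    obtain ⟨c, g, hg, hc⟩ := ih (f := g₁) (by exact_mod_cast hg₁)
    refine ⟨fun l => Nat.casesOn l (f 0) c, g, hg, fun ε hε => ?_⟩
    rw [hfg ε hε, hc ε hε, Finset.sum_range_succ', smul_add, Finset.smul_sum]
    simp only [pow_succ', mul_smul, pow_zero, one_smul]
    rw [add_comm, add_right_comm]
    rfl

end SmoothDivision

/-- The inverse function theorem, with smoothness of the local inverse on its whole domain. -/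
theorem ContDiffOn.exists_openPartialHomeomorph {𝕜 E F : Type*} [RCLike 𝕜]
    [NormedAddCommGroup E] [NormedSpace 𝕜 E] [CompleteSpace E]
    [NormedAddCommGroup F] [NormedSpace 𝕜 F] {m : WithTop ℕ∞} (hm : 1 ≤ m) {f : E → F} {s : Set E}
    (hf : ContDiffOn 𝕜 m f s) (hs : IsOpen s) {a : E} (ha : a ∈ s) (f' : E ≃L[𝕜] F)
    (hf' : HasFDerivAt f (f' : E →L[𝕜] F) a) :
    ∃ e : OpenPartialHomeomorph E F, a ∈ e.source ∧ e.source ⊆ s ∧ (∀ x, e x = f x) ∧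
      ContDiffOn 𝕜 m e.symm e.target := by
  have hm0 : m ≠ 0 := by rintro rfl; simp at hm
  let e₀ := (hf.contDiffAt (hs.mem_nhds ha)).toOpenPartialHomeomorph f hf' hm0
  have hc : ContinuousOn (fderiv 𝕜 f) s :=
    hf.continuousOn_fderiv_of_isOpen hs hm
  -- Invertible operators form an open set, so the source can be shrunk until the derivative is
  -- invertible at each of its points; the inverse is then smooth at each point of the target.
  let O : Set E := s ∩ fderiv 𝕜 f ⁻¹' Set.range ((↑) : (E ≃L[𝕜] F) → E →L[𝕜] F)
  have hO : IsOpen O := hc.isOpen_inter_preimage hs ContinuousLinearEquiv.isOpen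
  refine ⟨e₀.restrOpen O hO, ⟨?_, ha, f', hf'.fderiv.symm⟩, fun x hx => hx.2.1, fun x => rfl, ?_⟩
  · exact (hf.contDiffAt (hs.mem_nhds ha)).mem_toOpenPartialHomeomorph_source hf' hm0
  · intro y hy
    have hx := (e₀.restrOpen O hO).map_target hy
    obtain ⟨A, hA⟩ := hx.2.2
    refine ContDiffAt.contDiffWithinAt ?_
    refine OpenPartialHomeomorph.contDiffAt_symm (f₀' := A) _ hy ?_
      (hf.contDiffAt (hs.mem_nhds hx.2.1))
    rw [hA]
    exact ((hf.differentiableOn hm0).differentiableAt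
      (hs.mem_nhds hx.2.1)).hasFDerivAt

/-! ### Orders of vanishing in terms of Taylor coefficients -/

section Coefficients

variable {𝕜 : Type*} [RCLike 𝕜]

theorem isBigO_pow_smul_of_continuousAt {F : Type*} [NormedAddCommGroup F] [NormedSpace 𝕜 F]
    {j l : ℕ} (hjl : j ≤ l) {g : 𝕜 → F} (hg : ContinuousAt g 0) :
    (fun ε : 𝕜 => ε ^ l • g ε) =O[𝓝 0] fun ε : 𝕜 => ε ^ j := by
  have h1 : (fun ε : 𝕜 => ε ^ (l - j) • g ε) =O[𝓝 0] fun _ => (1 : 𝕜) :=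
    (ContinuousAt.tendsto (by fun_prop)).isBigO_one 𝕜
  have h2 := (isBigO_refl (fun ε : 𝕜 => ε ^ j) (𝓝 0)).smul h1
  refine h2.congr (fun ε => ?_) (fun ε => by simp)
  rw [smul_smul, ← pow_add, Nat.add_sub_cancel' hjl]

theorem isBigO_pow_of_coeff_eq_zero {F : Type*} [NormedAddCommGroup F] [NormedSpace 𝕜 F]
    {c : ℕ → F} {f : 𝕜 → F} {K j : ℕ}
    (hf : (fun ε => f ε - ∑ l ∈ Finset.range K, ε ^ l • c l) =O[𝓝 0] fun ε : 𝕜 => ε ^ K)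
    (hj : j ≤ K) (hc : ∀ l < j, c l = 0) : f =O[𝓝 0] fun ε : 𝕜 => ε ^ j := by
  have h1 : (fun ε : 𝕜 => ∑ l ∈ Finset.range K, ε ^ l • c l) =O[𝓝 0] fun ε : 𝕜 => ε ^ j := by
    refine IsBigO.fun_sum fun l _ => ?_
    by_cases hl : l < j
    · simp [hc l hl, isBigO_zero]
    · exact isBigO_pow_smul_of_continuousAt (not_lt.mp hl) continuousAt_const
  have h2 : (fun ε : 𝕜 => ε ^ K) =O[𝓝 0] fun ε : 𝕜 => ε ^ j := by
    simpa using isBigO_pow_smul_of_continuousAt (𝕜 := 𝕜) hj (continuousAt_const (y := (1 : 𝕜)))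
  simpa using (hf.trans h2).add h1

theorem eq_zero_of_pow_smul_isBigO {F : Type*} [NormedAddCommGroup F] [NormedSpace 𝕜 F]
    {c : F} {j : ℕ} (h : (fun ε : 𝕜 => ε ^ j • c) =O[𝓝 0] fun ε : 𝕜 => ε ^ (j + 1)) : c = 0 := by
  obtain ⟨C, hC⟩ := h.bound
  have h1 : ∀ᶠ ε : 𝕜 in 𝓝[≠] 0, ‖c‖ ≤ C * ‖ε‖ := by
    filter_upwards [hC.filter_mono nhdsWithin_le_nhds, self_mem_nhdsWithin] with ε h2 h3
    have h4 : 0 < ‖ε‖ ^ j := pow_pos (norm_pos_iff.mpr h3) j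
    rw [norm_smul, norm_pow, norm_pow, pow_succ] at h2
    refine le_of_mul_le_mul_left (h2.trans_eq ?_) h4
    ring
  have h2 : Tendsto (fun ε : 𝕜 => C * ‖ε‖) (𝓝[≠] 0) (𝓝 0) := by
    have : Tendsto (fun ε : 𝕜 => C * ‖ε‖) (𝓝 0) (𝓝 (C * ‖(0 : 𝕜)‖)) :=
      Continuous.tendsto (by fun_prop) _
    simp only [norm_zero, mul_zero] at this
    exact this.mono_left nhdsWithin_le_nhds
  exact norm_le_zero_iff.mp (ge_of_tendsto h2 h1)

/-- The order of vanishing of a function is read off from its Taylor coefficients. -/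
theorem isBigO_pow_iff_coeff {F : Type*} [NormedAddCommGroup F] [NormedSpace 𝕜 F]
    {c : ℕ → F} {f : 𝕜 → F} {K j : ℕ}
    (hf : (fun ε => f ε - ∑ l ∈ Finset.range K, ε ^ l • c l) =O[𝓝 0] fun ε : 𝕜 => ε ^ K)
    (hj : j ≤ K) : f =O[𝓝 0] (fun ε : 𝕜 => ε ^ j) ↔ ∀ l < j, c l = 0 := by
  refine ⟨fun h => ?_, isBigO_pow_of_coeff_eq_zero hf hj⟩
  induction j with
  | zero => simp
  | succ j ih =>
    have h0 : (fun ε : 𝕜 => ε ^ (j + 1)) =O[𝓝 0] fun ε : 𝕜 => ε ^ j := by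
      simpa using isBigO_pow_smul_of_continuousAt (𝕜 := 𝕜) (Nat.le_succ j)
        (continuousAt_const (y := (1 : 𝕜)))
    have h1 := ih (by lia) (h.trans h0)
    have h2 : (fun ε => f ε - ε ^ j • c j) =O[𝓝 0] fun ε : 𝕜 => ε ^ (j + 1) := by
      -- Subtracting the term of order `j` from `f` deletes exactly its coefficient `c j`.
      refine isBigO_pow_of_coeff_eq_zero (c := Function.update c j 0) (K := K) ?_ hj ?_
      · refine hf.congr_left fun ε => ?_
        have hmem : j ∈ Finset.range K := Finset.mem_range.mpr hj
        rw [← Finset.add_sum_erase _ _ hmem, ← Finset.add_sum_erase _ _ hmem]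
        have hs : ∑ l ∈ (Finset.range K).erase j, ε ^ l • Function.update c j 0 l =
            ∑ l ∈ (Finset.range K).erase j, ε ^ l • c l :=
          Finset.sum_congr rfl fun l hl => by
            rw [Function.update_of_ne (Finset.ne_of_mem_erase hl)]
        rw [hs]
        simp only [Function.update_self, smul_zero, zero_add]
        abel
      · intro l hl
        rcases eq_or_ne l j with rfl | hlj
        · simp
        · rw [Function.update_of_ne hlj]; exact h1 l (by lia)
    have h3 : c j = 0 := eq_zero_of_pow_smul_isBigO (𝕜 := 𝕜) (by simpa using h.sub h2)
    intro l hl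
    rcases eq_or_ne l j with rfl | hlj
    · exact h3
    · exact h1 l (by lia)

theorem isBigO_sub_pow_smul_iff_coeff {F : Type*} [NormedAddCommGroup F] [NormedSpace 𝕜 F]
    {c : ℕ → F} {f : 𝕜 → F} {K j : ℕ}
    (hf : (fun ε => f ε - ∑ l ∈ Finset.range K, ε ^ l • c l) =O[𝓝 0] fun ε : 𝕜 => ε ^ K)
    (hj : j < K) (y : F) :
    (fun ε => f ε - ε ^ j • y) =O[𝓝 0] (fun ε : 𝕜 => ε ^ (j + 1)) ↔
      (∀ l < j, c l = 0) ∧ c j = y := by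
  have h1 : (fun ε => (f ε - ε ^ j • y) -
      ∑ l ∈ Finset.range K, ε ^ l • (c l - Pi.single (M := fun _ => F) j y l)) =O[𝓝 0]
      fun ε : 𝕜 => ε ^ K := by
    refine hf.congr_left fun ε => ?_
    simp only [smul_sub, Finset.sum_sub_distrib]
    rw [Finset.sum_eq_single_of_mem (f := fun l => ε ^ l • Pi.single (M := fun _ => F) j y l) j
      (Finset.mem_range.mpr hj) (fun l _ hl => by simp [hl])]
    simp only [Pi.single_eq_same]
    abel
  rw [isBigO_pow_iff_coeff h1 hj]
  constructor
  · intro h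
    refine ⟨fun l hl => ?_, by simpa [sub_eq_zero] using h j (by lia)⟩
    have := h l (by lia)
    rwa [Pi.single_eq_of_ne (by lia), sub_zero] at this
  · rintro ⟨h, h'⟩ l hl
    rcases eq_or_ne l j with rfl | hlj
    · simp [h']
    · rw [Pi.single_eq_of_ne hlj, sub_zero]; exact h l (by lia)

variable {B : Type*} [NormedAddCommGroup B] [NormedSpace 𝕜 B]
  {B' : Type*} [NormedAddCommGroup B'] [NormedSpace 𝕜 B']

/-- The coefficient of order `l` of the product of an operator series and a vector series. -/
def convCoeff (A : ℕ → B →L[𝕜] B') (b : ℕ → B) (l : ℕ) : B' :=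
  ∑ p ∈ Finset.HasAntidiagonal.antidiagonal l, A p.1 (b p.2)

/-- The product of a series with the `s`-th power of the variable. -/
def shiftSeq {E : Type*} [Zero E] (s : ℕ) (b : ℕ → E) (l : ℕ) : E :=
  if s ≤ l then b (l - s) else 0

theorem convCoeff_sub (A : ℕ → B →L[𝕜] B') (b c : ℕ → B) (l : ℕ) :
    convCoeff A (b - c) l = convCoeff A b l - convCoeff A c l := by
  simp [convCoeff, Finset.sum_sub_distrib]

theorem convCoeff_sum {ι : Type*} (s : Finset ι) (A : ℕ → B →L[𝕜] B') (b : ι → ℕ → B) (l : ℕ) :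
    convCoeff A (∑ i ∈ s, b i) l = ∑ i ∈ s, convCoeff A (b i) l := by
  simp only [convCoeff, Finset.sum_apply, map_sum]
  exact Finset.sum_comm

theorem convCoeff_shift_one_succ (A : ℕ → B →L[𝕜] B') (b : ℕ → B) (l : ℕ) :
    convCoeff A (shiftSeq 1 b) (l + 1) = convCoeff A b l := by
  rw [convCoeff, Finset.Nat.sum_antidiagonal_succ']
  simp [shiftSeq, convCoeff]

theorem shiftSeq_succ {E : Type*} [Zero E] (s : ℕ) (b : ℕ → E) :
    shiftSeq (s + 1) b = shiftSeq 1 (shiftSeq s b) := by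
  ext l
  simp only [shiftSeq]
  by_cases h : s + 1 ≤ l
  · rw [if_pos h, if_pos (by lia), if_pos (by lia)]; congr 1; lia
  · rw [if_neg h]
    by_cases h' : 1 ≤ l
    · rw [if_pos h', if_neg (by lia)]
    · rw [if_neg h']

theorem convCoeff_shift_add (A : ℕ → B →L[𝕜] B') (b : ℕ → B) (s l : ℕ) :
    convCoeff A (shiftSeq s b) (l + s) = convCoeff A b l := by
  induction s with
  | zero => congr 1
  | succ s ih => rw [shiftSeq_succ, ← add_assoc, convCoeff_shift_one_succ, ih]

theorem convCoeff_shift_of_lt (A : ℕ → B →L[𝕜] B') (b : ℕ → B) {s l : ℕ} (h : l < s) :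
    convCoeff A (shiftSeq s b) l = 0 := by
  refine Finset.sum_eq_zero fun p hp => ?_
  have := Finset.HasAntidiagonal.antidiagonal.snd_le hp
  rw [shiftSeq, if_neg (by lia), map_zero]

/-- Taylor coefficients of the image of a polynomial curve. -/
theorem isBigO_apply_curve_sub_convCoeff {L : 𝕜 → B →L[𝕜] B'} {A : ℕ → B →L[𝕜] B'} {K : ℕ}
    (hA : (fun ε => L ε - ∑ l ∈ Finset.range K, ε ^ l • A l) =O[𝓝 0] fun ε : 𝕜 => ε ^ K)
    (b : ℕ → B) :
    (fun ε => L ε (∑ l ∈ Finset.range K, ε ^ l • b l) -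
      ∑ l ∈ Finset.range K, ε ^ l • convCoeff A b l) =O[𝓝 0] fun ε : 𝕜 => ε ^ K := by
  have h1 : (fun ε : 𝕜 => (L ε - ∑ l ∈ Finset.range K, ε ^ l • A l)
      (∑ l ∈ Finset.range K, ε ^ l • b l)) =O[𝓝 0] fun ε : 𝕜 => ε ^ K := by
    have h2 : (fun ε : 𝕜 => ∑ l ∈ Finset.range K, ε ^ l • b l) =O[𝓝 0] fun _ => (1 : 𝕜) :=
      (ContinuousAt.tendsto (by fun_prop)).isBigO_one 𝕜
    have h3 : (fun ε : 𝕜 => (L ε - ∑ l ∈ Finset.range K, ε ^ l • A l)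
      (∑ l ∈ Finset.range K, ε ^ l • b l)) =O[𝓝 0] fun ε : 𝕜 =>
        ‖L ε - ∑ l ∈ Finset.range K, ε ^ l • A l‖ * ‖∑ l ∈ Finset.range K, ε ^ l • b l‖ :=
      IsBigO.of_bound 1 (Eventually.of_forall fun ε => by
        rw [Real.norm_of_nonneg (by positivity), one_mul]
        exact ContinuousLinearMap.le_opNorm _ _)
    exact h3.trans ((hA.norm_left.mul h2.norm_left).congr_right fun ε => by simp)
  have h4 : (fun ε : 𝕜 => ∑ p ∈ (Finset.range K ×ˢ Finset.range K) with ¬ (p.1 + p.2 < K),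
      ε ^ (p.1 + p.2) • A p.1 (b p.2)) =O[𝓝 0] fun ε : 𝕜 => ε ^ K := by
    refine IsBigO.fun_sum fun p hp => ?_
    rw [Finset.mem_filter] at hp
    exact isBigO_pow_smul_of_continuousAt (not_lt.mp hp.2) continuousAt_const
  refine (h1.add h4).congr_left fun ε => ?_
  have h5 : ∑ l ∈ Finset.range K, ε ^ l • convCoeff A b l =
      ∑ p ∈ (Finset.range K ×ˢ Finset.range K).filter (fun p : ℕ × ℕ => p.1 + p.2 < K),
        ε ^ (p.1 + p.2) • A p.1 (b p.2) := by
    rw [← Finset.sum_fiberwise_of_maps_to (t := Finset.range K) (g := fun p : ℕ × ℕ => p.1 + p.2)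
      (fun p hp => by simpa using (Finset.mem_filter.mp hp).2)]
    refine Finset.sum_congr rfl fun l hl => ?_
    rw [convCoeff, Finset.smul_sum]
    have : ({p ∈ Finset.range K ×ˢ Finset.range K | p.1 + p.2 < K} : Finset (ℕ × ℕ)).filter
        (fun p => p.1 + p.2 = l) = Finset.HasAntidiagonal.antidiagonal l := by
      ext p
      simp only [Finset.mem_filter, Finset.mem_product, Finset.mem_range, Finset.HasAntidiagonal.mem_antidiagonal]
      rw [Finset.mem_range] at hl
      lia
    rw [this]
    refine Finset.sum_congr rfl fun p hp => ?_
    rw [Finset.HasAntidiagonal.mem_antidiagonal.mp hp]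
  have h6 : (∑ l ∈ Finset.range K, ε ^ l • A l) (∑ l ∈ Finset.range K, ε ^ l • b l) =
      ∑ p ∈ Finset.range K ×ˢ Finset.range K, ε ^ (p.1 + p.2) • A p.1 (b p.2) := by
    rw [Finset.sum_product]
    simp only [map_sum, sum_apply, smul_apply, map_smul, smul_smul, Finset.smul_sum]
    rw [Finset.sum_comm]
    simp only [← pow_add, add_comm]
  rw [sub_apply, h6, h5, ← Finset.sum_filter_add_sum_filter_not _ (fun p : ℕ × ℕ => p.1 + p.2 < K)]
  abel

theorem polyCurve_eq_sum_range {E : Type*} [NormedAddCommGroup E] [NormedSpace 𝕜 E] {k : ℕ}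
    (b : ℕ → E) (ε : 𝕜) :
    polyCurve (k := k) (fun i => b i) ε = ∑ l ∈ Finset.range (k + 1), ε ^ l • b l :=
  Fin.sum_univ_eq_sum_range (fun l => ε ^ l • b l) (k + 1)

theorem exists_seq_eq_fin {E : Type*} [Zero E] {k : ℕ} (b : Fin (k + 1) → E) :
    ∃ c : ℕ → E, b = fun i : Fin (k + 1) => c i :=
  ⟨fun l => if h : l < k + 1 then b ⟨l, h⟩ else 0, by ext i; simp [i.is_lt]⟩

variable {L : 𝕜 → B →L[𝕜] B'} {A : ℕ → B →L[𝕜] B'} {k : ℕ}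

/-- From here on ranks and leading coefficients are algebraic. Curves become infinite sequences,
since a coefficient of order at most `k` involves only the first `k + 1` terms. -/
theorem mem_rankAtLeast_iff_convCoeff
    (hA : (fun ε => L ε - ∑ l ∈ Finset.range (k + 1), ε ^ l • A l) =O[𝓝 0]
      fun ε : 𝕜 => ε ^ (k + 1)) {j : ℕ} (hj : j ≤ k + 1) (b₀ : B) :
    b₀ ∈ rankAtLeast L k j ↔ ∃ b : ℕ → B, b 0 = b₀ ∧ ∀ l < j, convCoeff A b l = 0 := by
  constructor
  · rintro ⟨b, rfl, hb⟩
    obtain ⟨c, rfl⟩ := exists_seq_eq_fin b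
    simp only [polyCurve_eq_sum_range] at hb
    exact ⟨c, rfl, (isBigO_pow_iff_coeff (isBigO_apply_curve_sub_convCoeff hA c) hj).mp hb⟩
  · rintro ⟨c, rfl, hc⟩
    refine ⟨fun i => c i, rfl, ?_⟩
    simp only [polyCurve_eq_sum_range]
    exact (isBigO_pow_iff_coeff (isBigO_apply_curve_sub_convCoeff hA c) hj).mpr hc

theorem mem_leadingCoeffs_iff_convCoeff
    (hA : (fun ε => L ε - ∑ l ∈ Finset.range (k + 1), ε ^ l • A l) =O[𝓝 0]
      fun ε : 𝕜 => ε ^ (k + 1)) {j : ℕ} (hj : j < k + 1) (y : B') :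
    y ∈ leadingCoeffs L k j ↔
      ∃ b : ℕ → B, (∀ l < j, convCoeff A b l = 0) ∧ convCoeff A b j = y := by
  constructor
  · rintro ⟨b, hb⟩
    obtain ⟨c, rfl⟩ := exists_seq_eq_fin b
    simp only [polyCurve_eq_sum_range] at hb
    exact ⟨c, (isBigO_sub_pow_smul_iff_coeff
      (isBigO_apply_curve_sub_convCoeff hA c) hj y).mp hb⟩
  · rintro ⟨c, hc⟩
    refine ⟨fun i => c i, ?_⟩
    simp only [polyCurve_eq_sum_range]
    exact (isBigO_sub_pow_smul_iff_coeff (isBigO_apply_curve_sub_convCoeff hA c) hj y).mpr hc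

end Coefficients

/-! ### Inductive construction of the Jordan chains -/

section JordanInduction

variable {𝕜 : Type*} [RCLike 𝕜]
  {B : Type*} [NormedAddCommGroup B] [NormedSpace 𝕜 B]
  {B' : Type*} [NormedAddCommGroup B'] [NormedSpace 𝕜 B']

/-- Jordan chains with leading coefficients in given complements, built up to order `j`. The maps
`π i`, `ν` and `P i` are the coordinate projections of the direct sums. -/
structure IsPartialJordanSeries {k : ℕ} (A : ℕ → B →L[𝕜] B') {Nc : Fin (k + 1) → Submodule 𝕜 B}
    {N : Submodule 𝕜 B} {R : Fin (k + 1) → Submodule 𝕜 B'}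
    (π : ∀ i, B →L[𝕜] Nc i) (ν : B →L[𝕜] N) (j : ℕ) (q : ℕ → B →L[𝕜] B) : Prop where
  zero : q 0 = ContinuousLinearMap.id 𝕜 B
  chain : ∀ i : Fin (k + 1), (i : ℕ) < j → ∃ S : Nc i ≃L[𝕜] R i, ∀ x : Nc i,
    (∀ l < (i : ℕ), convCoeff A (fun s => q s (x : B)) l = 0) ∧
      convCoeff A (fun s => q s (x : B)) i = S x
  tail : ∀ b : B, (∀ i : Fin (k + 1), (i : ℕ) < j → π i b = 0) →
    ∀ l < j, convCoeff A (fun s => q s b) l = 0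
  range_chain : ∀ i : Fin (k + 1), (i : ℕ) < j → ∀ (x : Nc i) (l : ℕ), l ≠ 0 →
    ν (q l x) = 0 ∧ ∀ h : Fin (k + 1), (i : ℕ) + 1 ≤ l + h → π h (q l x) = 0
  range_tail : ∀ b : B, (∀ i : Fin (k + 1), (i : ℕ) < j → π i b = 0) → ∀ l : ℕ, l ≠ 0 →
    ν (q l b) = 0 ∧ ∀ h : Fin (k + 1), j ≤ l + h → π h (q l b) = 0

-- On elements of rank at least `j` the coefficient of order `j` of the present chains lies in `R_1
-- ⊕ ⋯ ⊕ R_{j+1}`. Its parts in `R_1, …, R_j` are removed by subtracting earlier chains, shifted so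
-- that they start at order `j`. The remaining part in `R_{j+1}` defines the new chain operator,
-- which is injective by the description of ranks and surjective by that of leading coefficients.
set_option maxHeartbeats 800000 in
theorem IsPartialJordanSeries.step [CompleteSpace B] [CompleteSpace B'] {k : ℕ}
    {A : ℕ → B →L[𝕜] B'}
    {Nc : Fin (k + 1) → Submodule 𝕜 B} {N : Submodule 𝕜 B} {R : Fin (k + 1) → Submodule 𝕜 B'}
    [∀ i, CompleteSpace (Nc i)] [∀ i, CompleteSpace (R i)]
    {π : ∀ i, B →L[𝕜] Nc i} {ν : B →L[𝕜] N} {P : ∀ i, B' →L[𝕜] R i}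
    (hππ : ∀ i (x : Nc i), π i x = x) (hπ0 : ∀ i h, i ≠ h → ∀ x : Nc i, π h x = 0)
    (hν0 : ∀ i (x : Nc i), ν x = 0)
    (hPP : ∀ i (y : R i), P i y = y) (hP0 : ∀ i h, i ≠ h → ∀ y : R i, P h y = 0)
    (hP : ∀ y : B', ∑ i, (P i y : B') = y)
    (hrank : ∀ j ≤ k + 1, ∀ b₀ : B, (∃ b : ℕ → B, b 0 = b₀ ∧ ∀ l < j, convCoeff A b l = 0) ↔
      ∀ i : Fin (k + 1), (i : ℕ) < j → π i b₀ = 0)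
    (hlead : ∀ j ≤ k, ∀ y : B', (∃ b : ℕ → B, (∀ l < j, convCoeff A b l = 0) ∧
      convCoeff A b j = y) ↔ ∀ i : Fin (k + 1), j < (i : ℕ) → P i y = 0)
    {j : ℕ} (hj : j < k + 1) {q : ℕ → B →L[𝕜] B}
    (hq : IsPartialJordanSeries (R := R) A π ν j q) :
    ∃ q', IsPartialJordanSeries (R := R) A π ν (j + 1) q' := by
  let J : Fin (k + 1) := ⟨j, hj⟩
  have hinv : ∀ i : Fin (k + 1), ∃ V : R i →L[𝕜] Nc i, (i : ℕ) < j → ∀ y : R i,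
      (∀ l < (i : ℕ), convCoeff A (fun s => q s (V y : B)) l = 0) ∧
        convCoeff A (fun s => q s (V y : B)) i = y := by
    intro i
    by_cases hi : (i : ℕ) < j
    · obtain ⟨S, hS⟩ := hq.chain i hi
      refine ⟨(S.symm : R i →L[𝕜] Nc i), fun _ y => ?_⟩
      simpa using hS (S.symm y)
    · exact ⟨0, fun h => absurd h hi⟩
  choose V hV using hinv
  let T : B →L[𝕜] B' := ∑ p ∈ Finset.HasAntidiagonal.antidiagonal j, (A p.1).comp (q p.2)
  have hT : ∀ b, convCoeff A (fun s => q s b) j = T b := by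
    intro b
    simp [T, convCoeff, sum_apply]
  -- the projection onto the elements of rank at least `j`
  let I : Finset (Fin (k + 1)) := Finset.univ.filter fun i => (i : ℕ) < j
  let pr : B →L[𝕜] B :=
    ContinuousLinearMap.id 𝕜 B - ∑ i ∈ I, (Nc i).subtypeL.comp (π i)
  have hpr0 : ∀ i : Fin (k + 1), (i : ℕ) < j → ∀ x : Nc i, pr x = 0 := by
    intro i hi x
    simp only [pr, sub_apply, sum_apply, ContinuousLinearMap.id_apply,
      ContinuousLinearMap.comp_apply]
    rw [Finset.sum_eq_single_of_mem i (by simp [I, hi])]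
    · simp [hππ]
    · intro h _ hh
      simp [hπ0 i h hh.symm]
  have hpr1 : ∀ b, (∀ i : Fin (k + 1), (i : ℕ) < j → π i b = 0) → pr b = b := by
    intro b hb
    simp only [pr, sub_apply, sum_apply, ContinuousLinearMap.id_apply,
      ContinuousLinearMap.comp_apply]
    rw [Finset.sum_eq_zero, sub_zero]
    intro i hi
    simp [hb i (Finset.mem_filter.mp hi).2]
  -- The root of the earlier chain whose leading coefficient is the unwanted part in `R i`. The
  -- factor `pr` makes the correction vanish on the complements already treated, so their chains
  -- stay unchanged.
  let cor : ∀ i, B →L[𝕜] Nc i := fun i => (V i).comp ((P i).comp (T.comp pr))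
  have hcor : ∀ i b, cor i b = V i (P i (T (pr b))) := fun i b => rfl
  clear_value pr T cor
  -- The chain from `cor i b` starts at order `i`; multiplied by `ε ^ (j - i)` it starts at order
  -- `j` and leaves the lower orders alone.
  let q' : ℕ → B →L[𝕜] B := q - ∑ i ∈ I,
    shiftSeq (j - (i : ℕ)) (fun s => (q s).comp ((Nc i).subtypeL.comp (cor i)))
  have hq' : ∀ b, (fun s => q' s b) = (fun s => q s b) - ∑ i ∈ I,
      shiftSeq (j - (i : ℕ)) (fun s => q s (cor i b : B)) := by
    intro b
    ext s
    simp only [q', Pi.sub_apply, Finset.sum_apply, sub_apply, sum_apply]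
    congr 1
    refine Finset.sum_congr rfl fun i _ => ?_
    simp only [shiftSeq]
    split_ifs <;> simp
  have hq'0 : q' 0 = ContinuousLinearMap.id 𝕜 B := by
    simp only [q', Pi.sub_apply, Finset.sum_apply]
    rw [Finset.sum_eq_zero, sub_zero, hq.zero]
    intro i hi
    have := (Finset.mem_filter.mp hi).2
    rw [shiftSeq, if_neg (by lia)]
  clear_value q'
  have hq'old : ∀ i : Fin (k + 1), (i : ℕ) < j → ∀ x : Nc i, ∀ s, q' s x = q s x := by
    intro i hi x s
    have hc : ∀ h, cor h (x : B) = 0 := fun h => by simp [hcor, hpr0 i hi x]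
    have := congrFun (hq' x) s
    simp only [this, Pi.sub_apply, Finset.sum_apply]
    rw [Finset.sum_eq_zero, sub_zero]
    intro h _
    simp [shiftSeq, hc]
  have hlow : ∀ b, (∀ i : Fin (k + 1), (i : ℕ) < j → π i b = 0) → ∀ l < j,
      convCoeff A (fun s => q' s b) l = 0 := by
    intro b hb l hl
    rw [hq', convCoeff_sub, convCoeff_sum, hq.tail b hb l hl, zero_sub, neg_eq_zero]
    refine Finset.sum_eq_zero fun i hi => ?_
    have hi' := (Finset.mem_filter.mp hi).2
    by_cases hl' : l < j - (i : ℕ)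
    · exact convCoeff_shift_of_lt _ _ hl'
    · obtain ⟨l', rfl⟩ := Nat.exists_eq_add_of_le' (not_lt.mp hl')
      rw [convCoeff_shift_add]
      simp only [hcor]
      exact (hV i hi' _).1 l' (by lia)
  have htop : ∀ b, (∀ i : Fin (k + 1), (i : ℕ) < j → π i b = 0) →
      convCoeff A (fun s => q' s b) j = P J (T b) := by
    intro b hb
    have h1 : ∀ i : Fin (k + 1), j < (i : ℕ) → P i (T b) = 0 :=
      (hlead j (by lia) (T b)).mp ⟨fun s => q s b, hq.tail b hb, hT b⟩
    rw [hq', convCoeff_sub, convCoeff_sum, hT]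
    have h2 : ∀ i ∈ I, convCoeff A (shiftSeq (j - (i : ℕ)) fun s => q s (cor i b : B)) j =
        P i (T b) := by
      intro i hi
      have hi' := (Finset.mem_filter.mp hi).2
      have h3 := convCoeff_shift_add A (fun s => q s (cor i b : B)) (j - (i : ℕ)) i
      rw [Nat.add_sub_cancel' hi'.le] at h3
      rw [h3, hcor, hpr1 b hb]
      exact (hV i hi' _).2
    rw [Finset.sum_congr rfl h2, sub_eq_iff_eq_add]
    conv_lhs => rw [← hP (T b)]
    rw [← Finset.add_sum_erase _ _ (Finset.mem_univ J)]
    congr 1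
    symm
    refine Finset.sum_subset (fun i hi => ?_) (fun i hi hi' => ?_)
    · have := (Finset.mem_filter.mp hi).2
      refine Finset.mem_erase.mpr ⟨fun h => ?_, Finset.mem_univ _⟩
      simp [h, J] at this
    · have h4 : ¬ (i : ℕ) < j := fun h => hi' (Finset.mem_filter.mpr ⟨Finset.mem_univ _, h⟩)
      have h5 : (i : ℕ) ≠ j := fun h => (Finset.mem_erase.mp hi).1 (Fin.ext h)
      simp [h1 i (by lia)]
  -- leading coefficients of order `j` are given by `T` modulo lower ones
  have key : ∀ b : ℕ → B, (∀ l < j, convCoeff A b l = 0) →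
      (∀ i : Fin (k + 1), (i : ℕ) < j → π i (b 0) = 0) ∧
        P J (convCoeff A b j) = P J (T (b 0)) := by
    intro b hb
    have h0 := (hrank j (by lia) (b 0)).mp ⟨b, rfl, hb⟩
    refine ⟨h0, ?_⟩
    -- Both curves have the root `b 0`, so they differ by `ε d`. The order `j` coefficient of `ε d`
    -- is a leading coefficient of order `j - 1`, hence is killed by `P J`; for `j = 0` it is zero.
    let d : ℕ → B := fun l => b (l + 1) - q (l + 1) (b 0)
    have hd : b - (fun s => q s (b 0)) = shiftSeq 1 d := by
      ext l
      cases l with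
      | zero => simp [shiftSeq, hq.zero]
      | succ l => simp [shiftSeq, d]
    rw [← hT, ← sub_eq_zero, ← map_sub, ← convCoeff_sub, hd]
    obtain _ | j' := j
    · rw [convCoeff_shift_of_lt _ _ (by lia), map_zero]
    · rw [convCoeff_shift_one_succ]
      refine (hlead j' (by lia) _).mp ⟨d, fun l hl => ?_, rfl⟩ J (by simp [J])
      rw [← convCoeff_shift_one_succ, ← hd, convCoeff_sub, hb _ (by lia),
        hq.tail _ h0 _ (by lia), sub_zero]
  have key0 : ∀ b₀ : B, (∀ i : Fin (k + 1), (i : ℕ) < j + 1 → π i b₀ = 0) → P J (T b₀) = 0 := by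
    intro b₀ hb₀
    obtain ⟨b, rfl, hb⟩ := (hrank (j + 1) (by lia) b₀).mpr hb₀
    rw [← (key b fun l hl => hb l (by lia)).2, hb j (by lia), map_zero]
  let s : Nc J →L[𝕜] R J := (P J).comp (T.comp (Nc J).subtypeL)
  have hJlow : ∀ (x : Nc J) (i : Fin (k + 1)), (i : ℕ) < j → π i (x : B) = 0 := by
    intro x i hi
    exact hπ0 J i (fun h => by simp [← h, J] at hi) x
  have hker : LinearMap.ker (s : Nc J →ₗ[𝕜] R J) = ⊥ := by
    rw [LinearMap.ker_eq_bot']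
    intro x hx
    have hx : P J (T x) = 0 := hx
    have h1 := (hrank (j + 1) (by lia) (x : B)).mp ⟨fun s => q' s x, ?_, ?_⟩ J (by simp [J])
    · rwa [hππ] at h1
    · simp only [hq'0, ContinuousLinearMap.id_apply]
    · intro l hl
      rcases Nat.lt_succ_iff_lt_or_eq.mp hl with h | rfl
      · exact hlow x (hJlow x) l h
      · rw [htop x (hJlow x), hx]; rfl
  have hrange : LinearMap.range (s : Nc J →ₗ[𝕜] R J) = ⊤ := by
    rw [LinearMap.range_eq_top]
    intro r
    obtain ⟨b, hb, hbr⟩ := (hlead j (by lia) (r : B')).mpr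
      (fun i hi => hP0 J i (fun h => by simp [← h, J] at hi) r)
    obtain ⟨h1, h2⟩ := key b hb
    refine ⟨π J (b 0), ?_⟩
    -- The root `b 0` has rank at least `j`; removing its component in `Nc J` leaves rank at least
    -- `j + 1`, which does not contribute to `P J ∘ T`.
    have h3 := key0 (b 0 - (π J (b 0) : B)) (fun i hi => by
      rcases Nat.lt_succ_iff_lt_or_eq.mp hi with h | h
      · rw [map_sub, h1 i h, hJlow _ i h, sub_zero]
      · obtain rfl : i = J := Fin.ext h
        rw [map_sub, hππ, sub_self])
    rw [map_sub, map_sub, sub_eq_zero] at h3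
    change P J (T (π J (b 0) : B)) = r
    rw [← h3, ← h2, hbr, hPP]
  have hrest : ∀ b, (∀ i : Fin (k + 1), (i : ℕ) < j → π i b = 0) → ∀ l : ℕ, l ≠ 0 →
      ν (q' l b) = 0 ∧ ∀ h : Fin (k + 1), j + 1 ≤ l + h → π h (q' l b) = 0 := by
    intro b hb l hl
    have h1 := hq.range_tail b hb l hl
    have h2 : ∀ i ∈ I, ν (shiftSeq (j - (i : ℕ)) (fun s => q s (cor i b : B)) l) = 0 ∧
        ∀ h : Fin (k + 1), j + 1 ≤ l + h →
          π h (shiftSeq (j - (i : ℕ)) (fun s => q s (cor i b : B)) l) = 0 := by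
      intro i hi
      have hi' := (Finset.mem_filter.mp hi).2
      by_cases hl' : j - (i : ℕ) ≤ l
      · simp only [shiftSeq, if_pos hl']
        -- The root of the shifted chain sits in degree `j - i` and lies in `Nc i`, on the line
        -- where degree plus index equals `j`; the bound `j + 1` just excludes it.
        by_cases hl0 : l - (j - (i : ℕ)) = 0
        · rw [hl0, hq.zero]
          refine ⟨hν0 i _, fun h hh => hπ0 i h (fun e => ?_) _⟩
          rw [← e] at hh
          lia
        · obtain ⟨h3, h4⟩ := hq.range_chain i hi' (cor i b) _ hl0
          exact ⟨h3, fun h hh => h4 h (by lia)⟩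
      · simp only [shiftSeq, if_neg hl', map_zero, implies_true, and_self]
    have h3 := congrFun (hq' b) l
    simp only [Pi.sub_apply, Finset.sum_apply] at h3
    rw [h3]
    refine ⟨?_, fun h hh => ?_⟩
    · rw [map_sub, map_sum, h1.1, Finset.sum_eq_zero fun i hi => (h2 i hi).1, sub_zero]
    · rw [map_sub, map_sum, h1.2 h (by lia), Finset.sum_eq_zero fun i hi => (h2 i hi).2 h hh,
        sub_zero]
  have hcases : ∀ i : Fin (k + 1), (i : ℕ) < j + 1 → (i : ℕ) < j ∨ i = J := fun i hi =>
    (Nat.lt_succ_iff_lt_or_eq.mp hi).imp id fun h => Fin.ext h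
  refine ⟨q', hq'0, ?_, ?_, ?_, ?_⟩
  · intro i hi
    rcases hcases i hi with hi | rfl
    · simpa only [hq'old i hi] using hq.chain i hi
    · refine ⟨ContinuousLinearEquiv.ofBijective s hker hrange, fun x => ⟨hlow x (hJlow x), ?_⟩⟩
      exact htop x (hJlow x)
  · intro b hb l hl
    have hb' : ∀ i : Fin (k + 1), (i : ℕ) < j → π i b = 0 := fun i hi => hb i (by lia)
    rcases Nat.lt_succ_iff_lt_or_eq.mp hl with h | rfl
    · exact hlow b hb' l h
    · rw [htop b hb', key0 b hb]; rfl
  · intro i hi x l hl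
    rcases hcases i hi with hi | rfl
    · simpa only [hq'old i hi] using hq.range_chain i hi x l hl
    · exact hrest x (hJlow x) l hl
  · intro b hb l hl
    exact hrest b (fun i hi => hb i (by lia)) l hl

end JordanInduction

/-! ### Coordinates of the direct sums and existence of the Jordan chain data -/

section JordanPolynomial

variable {𝕜 : Type*} [RCLike 𝕜]
  {B : Type*} [NormedAddCommGroup B] [NormedSpace 𝕜 B]
  {B' : Type*} [NormedAddCommGroup B'] [NormedSpace 𝕜 B']
  {L : 𝕜 → B →L[𝕜] B'} {k : ℕ} {Nc : Fin (k + 1) → Submodule 𝕜 B} {N : Submodule 𝕜 B}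
  {R : Fin (k + 1) → Submodule 𝕜 B'}

/-- The closed summands are complete, so the open mapping theorem makes the coordinate projections
continuous. -/
theorem IsJordanDecomposition.exists_domain_equiv [CompleteSpace B]
    (hdec : IsJordanDecomposition L k Nc N R) :
    ∃ D : ((∀ i, Nc i) × N) ≃L[𝕜] B, ∀ x, D x = familySum Nc x.1 + (x.2 : B) := by
  have _ : ∀ i, CompleteSpace (Nc i) := fun i => (hdec.isClosed_Nc i).completeSpace_coe
  have _ : CompleteSpace N := hdec.isClosed_N.completeSpace_coe
  let f : ((∀ i, Nc i) × N) →L[𝕜] B :=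
    (∑ i, (Nc i).subtypeL.comp (ContinuousLinearMap.proj i)).comp
      (ContinuousLinearMap.fst 𝕜 _ _) + N.subtypeL.comp (ContinuousLinearMap.snd 𝕜 _ _)
  have hf : ∀ x, f x = familySum Nc x.1 + (x.2 : B) := fun x => by
    simp [f, familySum, sum_apply]
  have hb : Function.Bijective f := by
    rw [show (f : _ → B) = _ from funext hf]; exact hdec.direct_domain
  exact ⟨ContinuousLinearEquiv.ofBijective f (LinearMap.ker_eq_bot.mpr hb.1)
    (LinearMap.range_eq_top.mpr hb.2), hf⟩

theorem IsJordanDecomposition.exists_image_equiv [CompleteSpace B']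
    (hdec : IsJordanDecomposition L k Nc N R) :
    ∃ D : (∀ i, R i) ≃L[𝕜] B', ∀ y, D y = familySum R y := by
  have _ : ∀ i, CompleteSpace (R i) := fun i => (hdec.isClosed_R i).completeSpace_coe
  let f : (∀ i, R i) →L[𝕜] B' := ∑ i, (R i).subtypeL.comp (ContinuousLinearMap.proj i)
  have hf : ∀ x, f x = familySum R x := fun x => by
    simp [f, familySum, sum_apply]
  have hb : Function.Bijective f := by
    rw [show (f : _ → B') = _ from funext hf]; exact hdec.direct_image
  exact ⟨ContinuousLinearEquiv.ofBijective f (LinearMap.ker_eq_bot.mpr hb.1)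
    (LinearMap.range_eq_top.mpr hb.2), hf⟩

theorem familySum_single {E : Type*} [NormedAddCommGroup E] [NormedSpace 𝕜 E]
    (M : Fin (k + 1) → Submodule 𝕜 E) (i : Fin (k + 1)) (x : M i) :
    familySum M (Pi.single i x) = x := by
  rw [familySum, Finset.sum_eq_single i]
  · simp
  · intro h _ hh; simp [hh]
  · simp

/-- Existence of the Jordan chain operators and the Jordan chain polynomial. -/
theorem IsJordanDecomposition.exists_isJordanPolynomial [CompleteSpace B]
    [CompleteSpace B'] (hdec : IsJordanDecomposition L k Nc N R)
    (hk : IsKSurjective L k) {A : ℕ → B →L[𝕜] B'}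
    (hA : (fun ε => L ε - ∑ l ∈ Finset.range (k + 1), ε ^ l • A l) =O[𝓝 0]
      fun ε : 𝕜 => ε ^ (k + 1)) :
    ∃ (S : ∀ i, Nc i ≃L[𝕜] R i) (p : Fin (k + 1) → B →L[𝕜] B),
      IsJordanPolynomial L Nc N R S p := by
  have _ : ∀ i, CompleteSpace (Nc i) := fun i => (hdec.isClosed_Nc i).completeSpace_coe
  have _ : ∀ i, CompleteSpace (R i) := fun i => (hdec.isClosed_R i).completeSpace_coe
  obtain ⟨D, hD⟩ := hdec.exists_domain_equiv
  obtain ⟨E, hE⟩ := hdec.exists_image_equiv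
  let π : ∀ i, B →L[𝕜] Nc i := fun i => (ContinuousLinearMap.proj i).comp
    ((ContinuousLinearMap.fst 𝕜 _ _).comp (D.symm : B →L[𝕜] ((∀ i, Nc i) × N)))
  let ν : B →L[𝕜] N :=
    (ContinuousLinearMap.snd 𝕜 _ _).comp (D.symm : B →L[𝕜] ((∀ i, Nc i) × N))
  let P : ∀ i, B' →L[𝕜] R i := fun i => (ContinuousLinearMap.proj i).comp
    (E.symm : B' →L[𝕜] (∀ i, R i))
  have hDs : ∀ i (x : Nc i), D.symm x = (Pi.single i x, 0) := fun i x => by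
    rw [ContinuousLinearEquiv.symm_apply_eq, hD]; simp [familySum_single]
  have hEs : ∀ i (x : R i), E.symm x = Pi.single i x := fun i x => by
    rw [ContinuousLinearEquiv.symm_apply_eq, hE]; simp [familySum_single]
  have hππ : ∀ i (x : Nc i), π i x = x := fun i x => by simp [π, hDs]
  have hπ0 : ∀ i h, i ≠ h → ∀ x : Nc i, π h x = 0 := fun i h hh x => by
    simp [π, hDs, Pi.single_eq_of_ne hh.symm]
  have hν0 : ∀ i (x : Nc i), ν x = 0 := fun i x => by simp [ν, hDs]
  have hPP : ∀ i (x : R i), P i x = x := fun i x => by simp [P, hEs]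
  have hP0 : ∀ i h, i ≠ h → ∀ x : R i, P h x = 0 := fun i h hh x => by
    simp [P, hEs, Pi.single_eq_of_ne hh.symm]
  have hP : ∀ y : B', ∑ i, (P i y : B') = y := fun y => by
    have := hE (E.symm y)
    rw [ContinuousLinearEquiv.apply_symm_apply] at this
    exact this.symm
  have hπ : ∀ b, familySum Nc (fun i => π i b) + (ν b : B) = b := fun b => by
    have := hD (D.symm b)
    rw [ContinuousLinearEquiv.apply_symm_apply] at this
    exact this.symm
  have hrank : ∀ j ≤ k + 1, ∀ b₀ : B, (∃ b : ℕ → B, b 0 = b₀ ∧ ∀ l < j, convCoeff A b l = 0) ↔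
      ∀ i : Fin (k + 1), (i : ℕ) < j → π i b₀ = 0 := by
    intro j hj b₀
    rw [← mem_rankAtLeast_iff_convCoeff hA hj]
    conv_lhs => rw [← hπ b₀]
    exact hdec.rank_iff j hj _ _
  have hlead : ∀ j ≤ k, ∀ y : B', (∃ b : ℕ → B, (∀ l < j, convCoeff A b l = 0) ∧
      convCoeff A b j = y) ↔ ∀ i : Fin (k + 1), j < (i : ℕ) → P i y = 0 := by
    intro j hj y
    rw [← mem_leadingCoeffs_iff_convCoeff hA (by lia)]
    rcases hj.lt_or_eq with hj | rfl
    · conv_lhs => rw [← hP y]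
      exact hdec.leading_iff j hj _
    -- The order `j = k`, left out of `leading_iff`, is `k`-surjectivity.
    · exact iff_of_true (hk y) fun i hi => absurd i.is_lt (by lia)
  have hind : ∀ j ≤ k + 1, ∃ q, IsPartialJordanSeries (R := R) A π ν j q := by
    intro j
    induction j with
    | zero =>
      intro _
      refine ⟨Pi.single 0 (ContinuousLinearMap.id 𝕜 B), by simp, by simp, by simp, by simp, ?_⟩
      intro b _ l hl
      simp [Pi.single_eq_of_ne hl]
    | succ j ih =>
      intro hj
      obtain ⟨q, hq⟩ := ih (by lia)
      exact hq.step hππ hπ0 hν0 hPP hP0 hP hrank hlead hj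
  obtain ⟨q, hq⟩ := hind (k + 1) le_rfl
  choose S hS using fun i : Fin (k + 1) => hq.chain i i.is_lt
  have hcurve : ∀ (ε : 𝕜) (b : B), polyCurve (fun i : Fin (k + 1) => q i) ε b =
      ∑ l ∈ Finset.range (k + 1), ε ^ l • q l b := fun ε b => by
    rw [polyCurve_eq_sum_range]; simp [sum_apply]
  refine ⟨S, fun i => q i, hq.zero, fun i hi b => ?_, fun i x => ?_, fun n => ?_⟩
  · have hi' : (i : ℕ) ≠ 0 := fun h => hi (Fin.ext h)
    have hνn : ∀ n : N, ∀ h, π h (n : B) = 0 := fun n h => by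
      have : D.symm n = (0, n) := by
        rw [ContinuousLinearEquiv.symm_apply_eq, hD]; simp [familySum]
      simp [π, this]
    have h1 := hq.range_tail (ν b) (fun h _ => hνn _ h) i hi'
    have h2 := fun h : Fin (k + 1) => hq.range_chain h h.is_lt (π h b) i hi'
    have h3 : q i b = ∑ h, q i (π h b : B) + q i (ν b : B) := by
      conv_lhs => rw [← hπ b, map_add, familySum, map_sum]
    have h4 : ν (q i b) = 0 := by
      rw [h3, map_add, map_sum, h1.1, Finset.sum_eq_zero fun h _ => (h2 h).1, add_zero]
    refine ⟨fun h => π h (q i b), fun h hh => ?_, ?_⟩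
    · change π h (q i b) = 0
      rw [h3, map_add, map_sum, h1.2 h (by lia),
        Finset.sum_eq_zero fun g _ => (h2 g).2 h (by have := g.is_lt; lia), add_zero]
    · conv_lhs => rw [← hπ (q i b), h4]
      simp
  · simp only [hcurve]
    exact (isBigO_sub_pow_smul_iff_coeff
      (isBigO_apply_curve_sub_convCoeff hA fun s => q s (x : B)) i.is_lt _).mpr (hS i x)
  · simp only [hcurve]
    refine (isBigO_pow_iff_coeff
      (isBigO_apply_curve_sub_convCoeff hA fun s => q s (n : B)) le_rfl).mpr
      (hq.tail _ fun i _ => ?_)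
    have : D.symm n = (0, n) := by
      rw [ContinuousLinearEquiv.symm_apply_eq, hD]; simp [familySum]
    simp [π, this]

end JordanPolynomial

/-! ### Division of the increment of `G` by `ε ^ (2 * k)` -/

section BlowUp

variable {𝕜 : Type*} [RCLike 𝕜]
  {B : Type*} [NormedAddCommGroup B] [NormedSpace 𝕜 B]
  {B' : Type*} [NormedAddCommGroup B'] [NormedSpace 𝕜 B']
  {k : ℕ} {Nc : Fin (k + 1) → Submodule 𝕜 B} {N : Submodule 𝕜 B}
  {R : Fin (k + 1) → Submodule 𝕜 B'}

theorem contDiff_polyCurve {E : Type*} [NormedAddCommGroup E] [NormedSpace 𝕜 E] {n : WithTop ℕ∞}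
    (b : Fin (k + 1) → E) : ContDiff 𝕜 n fun ε : 𝕜 => polyCurve b ε :=
  ContDiff.sum fun i _ => (contDiff_id.pow i).smul contDiff_const

theorem polyCurve_zero {E : Type*} [NormedAddCommGroup E] [NormedSpace 𝕜 E]
    (b : Fin (k + 1) → E) : polyCurve b (0 : 𝕜) = b 0 := by
  rw [polyCurve, Fin.sum_univ_succ]
  simp

theorem scaledSum_zero {E : Type*} [NormedAddCommGroup E] [NormedSpace 𝕜 E]
    (M : Fin (k + 1) → Submodule 𝕜 E) (x : ∀ i, M i) :
    scaledSum M (0 : 𝕜) x = x (Fin.last k) := by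
  rw [scaledSum, Fin.sum_univ_castSucc, Finset.sum_eq_zero]
  · simp
  · intro i _
    have : k - (i.castSucc : ℕ) ≠ 0 := by have := i.is_lt; rw [Fin.val_castSucc]; lia
    rw [zero_pow this, zero_smul]

theorem sum_pow_smul_eq_pow_smul {F : Type*} [AddCommGroup F] [Module 𝕜 F] {i : ℕ} (hi : i ≤ k)
    (c : ℕ → F) (hc : ∀ l < i, c l = 0) (r : F) (ε : 𝕜) :
    ∑ l ∈ Finset.range (k + 1), ε ^ l • c l + ε ^ (k + 1) • r =
      ε ^ i • (c i + ε • (∑ s ∈ Finset.range (k - i), ε ^ s • c (i + 1 + s) +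
        ε ^ (k - i) • r)) := by
  have h1 : k + 1 = (i + 1) + (k - i) := by lia
  rw [h1, Finset.sum_range_add, Finset.sum_range_succ, Finset.sum_eq_zero, zero_add]
  · simp only [smul_add, Finset.smul_sum, smul_smul, pow_add, pow_one, add_assoc]
  · intro l hl
    rw [hc l (Finset.mem_range.mp hl), smul_zero]

/-- The scaled increment of `G` along the cone is `ε ^ (2 * k)` times a smooth map; in the
coordinates given by the Jordan chain operators this map is `h`, which is tangent to the
projection at the origin. -/
theorem IsJordanPolynomial.exists_blowup [CompleteSpace B']
    {m : ℕ∞} (hm : 1 ≤ m) {G : B → B'} (hG : ContDiff 𝕜 (m + k + 2) G)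
    {U : Set 𝕜} (hU : IsOpen U) (h0U : (0 : 𝕜) ∈ U)
    {z : 𝕜 → B} (hz : ContDiffOn 𝕜 (m + k + 2) z U) (hz0 : z 0 = 0)
    {L : 𝕜 → B →L[𝕜] B'} (hL : ∀ ε, L ε = fderiv 𝕜 G (z ε))
    {S : ∀ i, Nc i ≃L[𝕜] R i} {p : Fin (k + 1) → B →L[𝕜] B}
    (hp : IsJordanPolynomial L Nc N R S p)
    (Sig : (∀ i, Nc i) ≃L[𝕜] B') (hSig : ∀ φ, Sig φ = opSum S φ) :
    ∃ δ > 0, ball (0 : 𝕜) δ ⊆ U ∧ ∃ h : 𝕜 × ((∀ i, Nc i) × N) → ∀ i, Nc i,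
      ContDiffOn 𝕜 m h (ball (0 : 𝕜) δ ×ˢ Set.univ) ∧
      (∀ ε ∈ ball (0 : 𝕜) δ, ∀ x : (∀ i, Nc i) × N,
        G (z ε + ε ^ k • polyCurve p ε (scaledSum Nc ε x.1 + (x.2 : B))) =
          G (z ε) + ε ^ (2 * k) • opSum S (h (ε, x))) ∧
      (∀ ε, h (ε, 0) = 0) ∧
      HasFDerivAt h ((ContinuousLinearMap.fst 𝕜 (∀ i, Nc i) N).comp
        (ContinuousLinearMap.snd 𝕜 𝕜 ((∀ i, Nc i) × N))) 0 ∧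
      ∃ q : B → B →L[𝕜] B →L[𝕜] B', ContDiff 𝕜 m q ∧
        ∀ x : (∀ i, Nc i) × N, h (0, x) = x.1 + Sig.symm
          (q (x.1 (Fin.last k) + (x.2 : B)) (x.1 (Fin.last k) + (x.2 : B))
            (x.1 (Fin.last k) + (x.2 : B))) := by
  obtain ⟨δ, hδ, hδU⟩ := Metric.isOpen_iff.mp hU 0 h0U
  have hzδ := hz.mono hδU
  have hm0 : (m : WithTop ℕ∞) ≠ 0 := by
    have : m ≠ 0 := by rintro rfl; simp at hm
    exact_mod_cast this
  -- the expansion of `L(ε) p(ε)`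
  have hLs : ContDiffOn 𝕜 (m + (k + 1 : ℕ)) L (ball 0 δ) := by
    have h1 : ContDiff 𝕜 (m + (k + 1 : ℕ)) (fderiv 𝕜 G) := by
      refine hG.fderiv_right (le_of_eq ?_)
      push_cast
      rw [add_assoc, add_assoc, add_assoc, one_add_one_eq_two]
    have h2 : ContDiffOn 𝕜 (m + (k + 1 : ℕ)) z (ball 0 δ) := by
      refine hzδ.of_le ?_
      push_cast
      rw [← add_assoc]
      gcongr
      exact_mod_cast one_le_two
    exact (h1.comp_contDiffOn h2).congr fun ε _ => hL ε
  have hMs : ContDiffOn 𝕜 (m + (k + 1 : ℕ)) (fun ε => (L ε).comp (polyCurve p ε)) (ball 0 δ) :=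
    hLs.clm_comp (contDiff_polyCurve p).contDiffOn
  obtain ⟨c, g, hg, hcg⟩ := exists_contDiffOn_taylor (k + 1) hMs
  have hcgb : ∀ ε ∈ ball (0 : 𝕜) δ, ∀ b : B, L ε (polyCurve p ε b) =
      ∑ l ∈ Finset.range (k + 1), ε ^ l • c l b + ε ^ (k + 1) • g ε b := by
    intro ε hε b
    have := congrArg (fun T : B →L[𝕜] B' => T b) (hcg ε hε)
    simpa [sum_apply] using this
  have hexp : ∀ b : B, (fun ε => L ε (polyCurve p ε b) -
      ∑ l ∈ Finset.range (k + 1), ε ^ l • c l b) =O[𝓝 0] fun ε : 𝕜 => ε ^ (k + 1) := by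
    intro b
    have h1 : ContinuousAt (fun ε => g ε b) 0 :=
      ((hg.continuousOn.continuousAt (ball_mem_nhds 0 hδ)).clm_apply continuousAt_const)
    refine (isBigO_pow_smul_of_continuousAt (le_refl (k + 1)) h1).congr' ?_ EventuallyEq.rfl
    filter_upwards [ball_mem_nhds 0 hδ] with ε hε
    rw [hcgb ε hε b]
    abel
  have hcNc : ∀ (i : Fin (k + 1)) (x : Nc i), (∀ l < (i : ℕ), c l x = 0) ∧ c i x = S i x :=
    fun i x => (isBigO_sub_pow_smul_iff_coeff (hexp x) i.is_lt _).mp (hp.chain_Nc i x)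
  have hcN : ∀ n : N, ∀ l < k + 1, c l n = 0 := fun n =>
    (isBigO_pow_iff_coeff (hexp n) le_rfl).mp (hp.chain_N n)
  -- the quadratic remainder
  obtain ⟨Q, hQ, hQG⟩ := exists_contDiff_quadratic_remainder (n := m + k) (f := G)
    (by exact_mod_cast hG)
  have hQ : ContDiff 𝕜 m Q := hQ.of_le (by exact_mod_cast le_self_add)
  let co : ∀ i, ((∀ i, Nc i) × N) →L[𝕜] B := fun i => (Nc i).subtypeL.comp
    ((ContinuousLinearMap.proj i).comp (ContinuousLinearMap.fst 𝕜 _ _))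
  let cn : ((∀ i, Nc i) × N) →L[𝕜] B := N.subtypeL.comp (ContinuousLinearMap.snd 𝕜 _ _)
  have hco : ∀ i x, co i x = x.1 i := fun i x => rfl
  have hcn : ∀ x, cn x = x.2 := fun x => rfl
  let Y : 𝕜 → ((∀ i, Nc i) × N) →L[𝕜] B := fun ε =>
    (polyCurve p ε).comp (∑ i : Fin (k + 1), ε ^ (k - (i : ℕ)) • co i + cn)
  -- What remains of `L ε (Y ε x)` after removing `ε ^ k • opSum S x.1` and dividing by `ε ^ (k +
  -- 1)`.
  let Lam : 𝕜 → ((∀ i, Nc i) × N) →L[𝕜] B' := fun ε =>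
    ∑ i : Fin (k + 1), (∑ s ∈ Finset.range (k - i), ε ^ s • c (i + 1 + s) +
      ε ^ (k - (i : ℕ)) • g ε).comp (co i) + (g ε).comp cn
  have hY : ContDiff 𝕜 m Y :=
    (contDiff_polyCurve p).clm_comp ((ContDiff.sum fun i _ =>
      (contDiff_id.pow _).smul contDiff_const).add contDiff_const)
  have hLam : ContDiffOn 𝕜 m Lam (ball 0 δ) := by
    refine (ContDiffOn.sum fun i _ => ContDiffOn.clm_comp (ContDiffOn.add ?_ ?_)
      contDiffOn_const).add (hg.clm_comp contDiffOn_const)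
    · exact (ContDiff.sum fun s _ => (contDiff_id.pow _).smul contDiff_const).contDiffOn
    · exact (contDiff_id.pow _).contDiffOn.smul hg
  have hYx : ∀ ε x, Y ε x = polyCurve p ε (scaledSum Nc ε x.1 + (x.2 : B)) := by
    intro ε x
    simp [Y, hco, hcn, scaledSum, sum_apply]
  have hlin : ∀ ε ∈ ball (0 : 𝕜) δ, ∀ x : ((∀ i, Nc i) × N), L ε (Y ε x) =
      ε ^ k • (opSum S x.1 + ε • Lam ε x) := by
    intro ε hε x
    have h1 : ∀ i : Fin (k + 1), ε ^ (k - (i : ℕ)) • L ε (polyCurve p ε (x.1 i : B)) =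
        ε ^ k • ((S i (x.1 i) : B') + ε • (∑ s ∈ Finset.range (k - i), ε ^ s • c (i + 1 + s) +
          ε ^ (k - (i : ℕ)) • g ε) (x.1 i : B)) := by
      intro i
      have hik : (i : ℕ) ≤ k := Nat.le_of_lt_succ i.is_lt
      rw [hcgb ε hε, sum_pow_smul_eq_pow_smul hik (fun l => c l (x.1 i : B))
        (hcNc i (x.1 i)).1, smul_smul, ← pow_add, Nat.sub_add_cancel hik, (hcNc i (x.1 i)).2]
      simp [sum_apply]
    have h2 : L ε (polyCurve p ε (x.2 : B)) = ε ^ k • ε • g ε (x.2 : B) := by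
      rw [hcgb ε hε, Finset.sum_eq_zero, zero_add, pow_succ, mul_smul]
      intro l hl
      rw [hcN _ l (Finset.mem_range.mp hl), smul_zero]
    rw [hYx, map_add, map_add, h2, scaledSum, map_sum, map_sum]
    simp only [map_smul, h1]
    rw [← Finset.smul_sum, ← smul_add, Finset.sum_add_distrib, ← Finset.smul_sum, opSum,
      add_assoc, ← smul_add]
    simp [Lam, hco, hcn, sum_apply]
  -- The two bilinear arguments `ε ^ k • Y` of the remainder give `ε ^ (2 * k)`, as do the outer
  -- factor `ε ^ k` and the factor `ε ^ k` of the linear part.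
  let H : 𝕜 × ((∀ i, Nc i) × N) → B' := fun y => opSum S y.2.1 + y.1 • Lam y.1 y.2 +
    Q (z y.1, y.1 ^ k • Y y.1 y.2) (Y y.1 y.2) (Y y.1 y.2)
  have hmaps : Set.MapsTo (Prod.fst : 𝕜 × ((∀ i, Nc i) × N) → 𝕜) (ball (0 : 𝕜) δ ×ˢ Set.univ) (ball 0 δ) :=
    fun y hy => hy.1
  have hYc : ContDiff 𝕜 m fun y : 𝕜 × ((∀ i, Nc i) × N) => Y y.1 y.2 :=
    (hY.comp contDiff_fst).clm_apply contDiff_snd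
  have hLamc : ContDiffOn 𝕜 m (fun y : 𝕜 × ((∀ i, Nc i) × N) => Lam y.1 y.2) (ball (0 : 𝕜) δ ×ˢ Set.univ) :=
    (hLam.comp contDiff_fst.contDiffOn hmaps).clm_apply contDiff_snd.contDiffOn
  have hzm : ContDiffOn 𝕜 m z (ball 0 δ) := hzδ.of_le (by
    rw [add_assoc]; exact_mod_cast le_self_add)
  have hWc : ContDiffOn 𝕜 m (fun y : 𝕜 × ((∀ i, Nc i) × N) => Q (z y.1, y.1 ^ k • Y y.1 y.2) (Y y.1 y.2))
      (ball (0 : 𝕜) δ ×ˢ Set.univ) := by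
    refine ContDiffOn.clm_apply (hQ.comp_contDiffOn ?_) hYc.contDiffOn
    exact (hzm.comp contDiff_fst.contDiffOn hmaps).prodMk
      ((contDiff_fst.pow k).smul hYc).contDiffOn
  have hSigH : ∀ y, Sig.symm (H y) = y.2.1 + Sig.symm (y.1 • Lam y.1 y.2 +
      Q (z y.1, y.1 ^ k • Y y.1 y.2) (Y y.1 y.2) (Y y.1 y.2)) := by
    intro y
    simp only [H]
    rw [add_assoc, map_add, ← hSig, ContinuousLinearEquiv.symm_apply_apply]
  have hY0 : ∀ x, Y 0 x = x.1 (Fin.last k) + (x.2 : B) := fun x => by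
    rw [hYx, polyCurve_zero, scaledSum_zero, hp.coeff_zero, ContinuousLinearMap.id_apply]
  have hnhds : ball (0 : 𝕜) δ ×ˢ (Set.univ : Set ((∀ i, Nc i) × N)) ∈ 𝓝 (0 : 𝕜 × ((∀ i, Nc i) × N)) :=
    prod_mem_nhds (ball_mem_nhds 0 hδ) univ_mem
  refine ⟨δ, hδ, hδU, fun y => Sig.symm (H y), ?_, ?_, ?_, ?_, ?_⟩
  · simp only [hSigH]
    refine (contDiff_fst.comp contDiff_snd).contDiffOn.add
      (Sig.symm.contDiff.comp_contDiffOn ?_)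
    exact (contDiff_fst.contDiffOn.smul hLamc).add (hWc.clm_apply hYc.contDiffOn)
  · intro ε hε x
    rw [← hYx, hQG, ← hL, map_smul, hlin ε hε, ← hSig (Sig.symm _),
      ContinuousLinearEquiv.apply_symm_apply]
    simp only [H, map_smul, smul_apply, smul_smul, ← pow_add, two_mul, smul_add, add_assoc, ← mul_assoc]
  · intro ε
    simp [hSigH]
  · simp only [hSigH]
    -- Both factors vanish at the origin, so the product rule gives derivative zero; the same holds
    -- for the quadratic term.
    have hl : HasFDerivAt (fun y : 𝕜 × ((∀ i, Nc i) × N) => y.1 • Lam y.1 y.2) (0 : 𝕜 × ((∀ i, Nc i) × N) →L[𝕜] B') 0 := by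
      have h1 := ((hLamc.contDiffAt hnhds).differentiableAt hm0).hasFDerivAt
      have h2 := (hasFDerivAt_fst (𝕜 := 𝕜) (p := (0 : 𝕜 × ((∀ i, Nc i) × N)))).smul h1
      convert! h2 using 1
      simp
    have hq : HasFDerivAt (fun y : 𝕜 × ((∀ i, Nc i) × N) => Q (z y.1, y.1 ^ k • Y y.1 y.2) (Y y.1 y.2)
        (Y y.1 y.2)) (0 : 𝕜 × ((∀ i, Nc i) × N) →L[𝕜] B') 0 := by
      have h1 := ((hWc.contDiffAt hnhds).differentiableAt hm0).hasFDerivAt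
      have h2 := (hYc.contDiffAt.differentiableAt hm0 (x := (0 : 𝕜 × ((∀ i, Nc i) × N)))).hasFDerivAt
      convert! h1.clm_apply h2 using 1
      simp
    have h3 := ((ContinuousLinearMap.fst 𝕜 (∀ i, Nc i) N).comp
        (ContinuousLinearMap.snd 𝕜 𝕜 ((∀ i, Nc i) × N))).hasFDerivAt (x := 0) |>.add
      ((Sig.symm : B' →L[𝕜] (∀ i, Nc i)).hasFDerivAt.comp (0 : 𝕜 × ((∀ i, Nc i) × N)) (hl.add hq))
    convert! h3 using 1
    simp
  -- The factor `0 ^ k` is `1` for `k = 0`: only then does the form depend on `η`.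
  · refine ⟨fun η => Q (0, (0 : 𝕜) ^ k • η), hQ.comp (by fun_prop), fun x => ?_⟩
    simp [hSigH, hY0, hz0]

end BlowUp

/-! ### Quadratic structure at `ε = 0` -/

section NearIdentity

variable {𝕜 : Type*} [RCLike 𝕜]

set_option maxSynthPendingDepth 3 in
/-- Solutions of `η + a (q(η) η η) = ℓ w` depend on `w` in such a way that the quadratic terms
`τ i (q(η) η η)` are smooth families of quadratic forms in `w`. -/
theorem exists_quadratic_form_of_perturbed_eq {B F X ι : Type*} {Z : ι → Type*}
    [NormedAddCommGroup B] [NormedSpace 𝕜 B] [CompleteSpace B]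
    [NormedAddCommGroup F] [NormedSpace 𝕜 F] [NormedAddCommGroup X] [NormedSpace 𝕜 X]
    [∀ i, NormedAddCommGroup (Z i)] [∀ i, NormedSpace 𝕜 (Z i)]
    {m : WithTop ℕ∞} (hm : 1 ≤ m) {q : B → B →L[𝕜] B →L[𝕜] F} (hq : ContDiff 𝕜 m q)
    (a : F →L[𝕜] B) (ℓ : X →L[𝕜] B) (τ : ∀ i, F →L[𝕜] Z i) :
    ∃ ρ > 0, ∃ O ∈ 𝓝 (0 : B), ∃ χ : ∀ i, X → X →L[𝕜] X →L[𝕜] Z i,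
      (∀ i, ContDiffOn 𝕜 m (χ i) (ball 0 ρ)) ∧
      ∀ η ∈ O, ∀ w ∈ ball (0 : X) ρ, η + a (q η η η) = ℓ w →
        ∀ i, τ i (q η η η) = χ i w w w := by
  have hm0 : m ≠ 0 := by rintro rfl; simp at hm
  have hqη : ContDiff 𝕜 m fun η => q η η := hq.clm_apply contDiff_id
  have hf : ContDiff 𝕜 m fun η => η + a (q η η η) :=
    contDiff_id.add (a.contDiff.comp (hqη.clm_apply contDiff_id))
  have hf' : HasFDerivAt (fun η => η + a (q η η η))
      (ContinuousLinearEquiv.refl 𝕜 B : B →L[𝕜] B) 0 := by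
    have h1 := (hqη.contDiffAt.differentiableAt hm0 (x := (0 : B))).hasFDerivAt
    have h2 := h1.clm_apply (hasFDerivAt_id (𝕜 := 𝕜) (0 : B))
    have h3 := (hasFDerivAt_id (𝕜 := 𝕜) (0 : B)).add (a.hasFDerivAt.comp (0 : B) h2)
    convert! h3 using 1
    ext
    simp
  obtain ⟨e, h0e, -, he, hes⟩ := hf.contDiffOn.exists_openPartialHomeomorph hm isOpen_univ
    (Set.mem_univ 0) _ hf'
  have he0 : e 0 = 0 := by simp [he]
  -- The equation reads `T η η = ℓ w`. With `κ w` the local solution, `A w = (T (κ w))⁻¹ ∘ ℓ`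
  -- satisfies `η = A w w`; inserting this in both arguments of `q η` exhibits the form in `w`.
  let T : B → B →L[𝕜] B := fun η => ContinuousLinearMap.id 𝕜 B + a.comp (q η η)
  have hT : ContDiff 𝕜 m T := contDiff_const.add (contDiff_const.clm_comp hqη)
  let O₁ : Set B := e.target ∩ e.symm ⁻¹' (T ⁻¹' {t | IsUnit t})
  have hO₁ : IsOpen O₁ :=
    e.isOpen_inter_preimage_symm (Units.isOpen.preimage hT.continuous)
  have h0t : (0 : B) ∈ e.target := he0 ▸ e.map_source h0e
  have h0s : e.symm 0 = 0 := by
    have := e.left_inv h0e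
    rwa [he0] at this
  have h0O₁ : ℓ 0 ∈ O₁ := by
    rw [map_zero]
    refine ⟨h0t, ?_⟩
    simp only [Set.mem_preimage, h0s, T, map_zero, Set.mem_ofPred_eq]
    rw [ContinuousLinearMap.comp_zero, add_zero]
    exact isUnit_one
  obtain ⟨ρ, hρ, hρO⟩ := Metric.isOpen_iff.mp (hO₁.preimage ℓ.continuous) 0 h0O₁
  let κ : X → B := fun w => e.symm (ℓ w)
  have hκ : ContDiffOn 𝕜 m κ (ball 0 ρ) :=
    hes.comp ℓ.contDiff.contDiffOn fun w hw => (hρO hw).1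
  let A : X → X →L[𝕜] B := fun w => (Ring.inverse (T (κ w))).comp ℓ
  have hA : ContDiffOn 𝕜 m A (ball 0 ρ) := by
    refine ContDiffOn.clm_comp ?_ contDiffOn_const
    intro w hw
    obtain ⟨t, ht⟩ := (hρO hw).2
    have h1 : ContDiffAt 𝕜 m Ring.inverse (T (κ w)) := by
      have := contDiffAt_ringInverse 𝕜 (n := m) t
      rwa [ht] at this
    exact h1.comp_contDiffWithinAt w ((hT.contDiffAt).comp_contDiffWithinAt w (hκ w hw))
  have hAw : ∀ η ∈ e.source, ∀ w ∈ ball (0 : X) ρ, η + a (q η η η) = ℓ w →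
      κ w = η ∧ A w w = η := by
    intro η hη w hw hw'
    have h1 : κ w = η := by
      simp only [κ]
      rw [← hw', ← he, e.left_inv hη]
    refine ⟨h1, ?_⟩
    have h2 : T η η = ℓ w := by simpa [T] using hw'
    have h3 : IsUnit (T (κ w)) := (hρO hw).2
    have h4 := congrArg (fun t : B →L[𝕜] B => t η) (Ring.inverse_mul_cancel _ h3)
    simp only [A, ContinuousLinearMap.comp_apply, ← h2]
    rw [h1] at h4 ⊢
    exact h4
  refine ⟨ρ, hρ, e.source, e.open_source.mem_nhds h0e, fun i w =>
    ((ContinuousLinearMap.compL 𝕜 X B (Z i)).flip (A w)).comp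
      ((ContinuousLinearMap.compL 𝕜 B F (Z i) (τ i)).comp ((q (κ w)).comp (A w))), fun i => ?_, ?_⟩
  · let pre : (X →L[𝕜] B) →L[𝕜] (B →L[𝕜] Z i) →L[𝕜] (X →L[𝕜] Z i) :=
      (ContinuousLinearMap.compL 𝕜 X B (Z i)).flip
    have hpre : ContDiff 𝕜 m pre := pre.contDiff
    refine ContDiffOn.clm_comp (hpre.comp_contDiffOn hA) ?_
    exact contDiffOn_const.clm_comp ((hq.comp_contDiffOn hκ).clm_comp hA)
  · intro η hη w hw hw' i
    obtain ⟨h1, h2⟩ := hAw η hη w hw hw'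
    simp [h1, h2]

end NearIdentity

/-! ### Linear rescaling for `ε ≠ 0`, and the linearization -/

section Cone

variable {𝕜 : Type*} [RCLike 𝕜]
  {B : Type*} [NormedAddCommGroup B] [NormedSpace 𝕜 B]
  {k : ℕ} {Nc : Fin (k + 1) → Submodule 𝕜 B} {N : Submodule 𝕜 B}

theorem exists_cone_equiv (D : ((∀ i, Nc i) × N) ≃L[𝕜] B)
    (hD : ∀ x, D x = familySum Nc x.1 + (x.2 : B)) {p : Fin (k + 1) → B →L[𝕜] B} {ε : 𝕜}
    (hε : ε ≠ 0) (hp : IsUnit (polyCurve p ε)) :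
    ∃ T : ((∀ i, Nc i) × N) ≃L[𝕜] B, ∀ x,
      T x = ε ^ k • polyCurve p ε (scaledSum Nc ε x.1 + (x.2 : B)) := by
  obtain ⟨u, hu⟩ := hp
  have hc : ∀ j, ε ^ j ≠ 0 := fun j => pow_ne_zero j hε
  let s : (∀ i, Nc i) ≃L[𝕜] (∀ i, Nc i) := ContinuousLinearEquiv.piCongrRight fun i =>
    ContinuousLinearEquiv.smulLeft (Units.mk0 (ε ^ (k - (i : ℕ))) (hc _))
  refine ⟨((s.prodCongr (ContinuousLinearEquiv.refl 𝕜 N)).trans D).trans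
    ((ContinuousLinearEquiv.unitsEquiv 𝕜 B u).trans
      (ContinuousLinearEquiv.smulLeft (Units.mk0 (ε ^ k) (hc _)))), fun x => ?_⟩
  have h1 : familySum Nc (s x.1) = scaledSum Nc ε x.1 := by
    simp only [familySum, scaledSum]
    rfl
  rw [← h1, ← hu]
  simp only [ContinuousLinearEquiv.trans_apply, hD]
  rfl

end Cone

/-- The map `(ε, x, n) ↦ (ε, h, n)` is inverted near the origin; away from `ε = 0` the inverse is
transported to `B` by the linear isomorphism of `exists_cone_equiv`. -/
theorem IsJordanPolynomial.exists_linearization {𝕜 : Type*} [RCLike 𝕜]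
    {B : Type*} [NormedAddCommGroup B] [NormedSpace 𝕜 B] [CompleteSpace B]
    {B' : Type*} [NormedAddCommGroup B'] [NormedSpace 𝕜 B'] [CompleteSpace B']
    {k : ℕ} {m : ℕ∞} (hm : 1 ≤ m) {G : B → B'} (hG : ContDiff 𝕜 (m + k + 2) G)
    {U : Set 𝕜} (hU : IsOpen U) (h0U : (0 : 𝕜) ∈ U)
    {z : 𝕜 → B} (hz : ContDiffOn 𝕜 (m + k + 2) z U) (hz0 : z 0 = 0)
    {L : 𝕜 → B →L[𝕜] B'} (hL : ∀ ε, L ε = fderiv 𝕜 G (z ε))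
    {Nc : Fin (k + 1) → Submodule 𝕜 B} {N : Submodule 𝕜 B} {R : Fin (k + 1) → Submodule 𝕜 B'}
    (hdec : IsJordanDecomposition L k Nc N R)
    {S : ∀ i, Nc i ≃L[𝕜] R i} {p : Fin (k + 1) → B →L[𝕜] B}
    (hp : IsJordanPolynomial L Nc N R S p) :
    ∃ δ > 0, ∃ ρ > 0, ball (0 : 𝕜) δ ⊆ U ∧
      ∃ ψ : 𝕜 × ((∀ i, Nc i) × N) → ∀ i, Nc i,
        ContDiffOn 𝕜 m ψ (ball (0 : 𝕜) δ ×ˢ ball (0 : (∀ i, Nc i) × N) ρ) ∧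
        (∀ ε ∈ ball (0 : 𝕜) δ, ψ (ε, 0) = 0) ∧
        (∀ ε ∈ ball (0 : 𝕜) δ, ∀ x ∈ ball (0 : (∀ i, Nc i) × N) ρ,
          G (coneMap z p ψ ε x) = G (z ε) + ε ^ (2 * k) • opSum S x.1) ∧
        (∃ χ : ∀ i, N × Nc (Fin.last k) →
            (N × Nc (Fin.last k)) →L[𝕜] (N × Nc (Fin.last k)) →L[𝕜] Nc i,
          (∀ i, ContDiffOn 𝕜 m (χ i) (ball 0 ρ)) ∧
          ∀ x ∈ ball (0 : (∀ i, Nc i) × N) ρ, ∀ i,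
            ψ (0, x) i = x.1 i +
              χ i (x.2, x.1 (Fin.last k)) (x.2, x.1 (Fin.last k)) (x.2, x.1 (Fin.last k))) ∧
        ∀ ε ∈ ball (0 : 𝕜) δ, ε ≠ 0 →
          ∃ Φ : OpenPartialHomeomorph ((∀ i, Nc i) × N) B,
            Φ.source = ball 0 ρ ∧
            Set.EqOn Φ (coneMap z p ψ ε) (ball 0 ρ) ∧
            z ε ∈ Φ.target ∧
            ContDiffOn 𝕜 m Φ Φ.source ∧
            ContDiffOn 𝕜 m Φ.symm Φ.target ∧
            ∀ φ ∈ ball (0 : ∀ i, Nc i) ρ,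
              {b ∈ Φ.target | G b = G (z ε) + ε ^ (2 * k) • opSum S φ} =
                (fun n : N => coneMap z p ψ ε (φ, n)) '' ball (0 : N) ρ := by
  have _ : ∀ i, CompleteSpace (Nc i) := fun i => (hdec.isClosed_Nc i).completeSpace_coe
  have _ : CompleteSpace N := hdec.isClosed_N.completeSpace_coe
  have hm' : (1 : WithTop ℕ∞) ≤ m := by exact_mod_cast hm
  obtain ⟨D, hD⟩ := hdec.exists_domain_equiv
  obtain ⟨E, hE⟩ := hdec.exists_image_equiv
  let Sig : (∀ i, Nc i) ≃L[𝕜] B' := (ContinuousLinearEquiv.piCongrRight S).trans E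
  have hSig : ∀ φ, Sig φ = opSum S φ := fun φ => hE _
  obtain ⟨δ₀, hδ₀, hδ₀U, h, hh, hhG, hh0, hh', q, hq, hhq⟩ :=
    hp.exists_blowup hm hG hU h0U hz hz0 hL Sig hSig
  -- the local inverse of the blow up
  let f : 𝕜 × ((∀ i, Nc i) × N) → 𝕜 × ((∀ i, Nc i) × N) := fun y => (y.1, (h y, y.2.2))
  have hf : ContDiffOn 𝕜 m f (ball (0 : 𝕜) δ₀ ×ˢ Set.univ) :=
    contDiff_fst.contDiffOn.prodMk (hh.prodMk (contDiff_snd.comp contDiff_snd).contDiffOn)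
  have hf' : HasFDerivAt f (ContinuousLinearEquiv.refl 𝕜 (𝕜 × ((∀ i, Nc i) × N)) :
      𝕜 × ((∀ i, Nc i) × N) →L[𝕜] 𝕜 × ((∀ i, Nc i) × N)) 0 :=
    (hasFDerivAt_fst (𝕜 := 𝕜) (p := (0 : 𝕜 × ((∀ i, Nc i) × N)))).prodMk (hh'.prodMk
      ((ContinuousLinearMap.snd 𝕜 (∀ i, Nc i) N).comp
        (ContinuousLinearMap.snd 𝕜 𝕜 ((∀ i, Nc i) × N))).hasFDerivAt)
  obtain ⟨e, h0e, hes, hef, hesm⟩ := hf.exists_openPartialHomeomorph hm'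
    (isOpen_ball.prod isOpen_univ) (a := 0) ⟨mem_ball_self hδ₀, trivial⟩ _ hf'
  have hf0 : ∀ ε, f (ε, 0) = (ε, 0) := fun ε => by simp [f, hh0]
  have he0 : e 0 = 0 := by rw [hef]; exact hf0 0
  have h0t : (0 : 𝕜 × ((∀ i, Nc i) × N)) ∈ e.target := he0 ▸ e.map_source h0e
  have h0s : e.symm 0 = 0 := by
    have := e.left_inv h0e
    rwa [he0] at this
  -- Since `f` fixes `ε` and `n`, only this component of the inverse is new.
  let ψ : 𝕜 × ((∀ i, Nc i) × N) → ∀ i, Nc i := fun y => (e.symm y).2.1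
  have hψ : ∀ y ∈ e.target, e.symm y = (y.1, (ψ y, y.2.2)) ∧ h (y.1, (ψ y, y.2.2)) = y.2.1 := by
    intro y hy
    have h1 := e.right_inv hy
    rw [hef] at h1
    have h3 : (f (e.symm y)).1 = y.1 := congrArg Prod.fst h1
    have h4 : (f (e.symm y)).2.2 = y.2.2 := congrArg (fun t => t.2.2) h1
    have h2 : e.symm y = (y.1, (ψ y, y.2.2)) := Prod.ext h3 (Prod.ext rfl h4)
    refine ⟨h2, ?_⟩
    rw [← h2]
    exact congrArg (fun t => t.2.1) h1
  -- the near identity relation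
  let ℓ : N × Nc (Fin.last k) →L[𝕜] B :=
    (Nc (Fin.last k)).subtypeL.comp (ContinuousLinearMap.snd 𝕜 _ _) +
      N.subtypeL.comp (ContinuousLinearMap.fst 𝕜 _ _)
  let a : B' →L[𝕜] B := (Nc (Fin.last k)).subtypeL.comp
    ((ContinuousLinearMap.proj (Fin.last k)).comp (Sig.symm : B' →L[𝕜] (∀ i, Nc i)))
  -- At `ε = 0` the last component of `h (0, (ψ, n)) = φ`, with `n` added to both sides, is an
  -- equation for `η = ψ_{k+1} + n`. The minus sign appears because `ψ i` equals `φ i` minus the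
  -- quadratic term.
  obtain ⟨ρ₁, hρ₁, O, hO, χ, hχ, hχO⟩ := exists_quadratic_form_of_perturbed_eq hm' hq a ℓ
    (fun i => -((ContinuousLinearMap.proj i).comp (Sig.symm : B' →L[𝕜] (∀ i, Nc i))))
  let η : (∀ i, Nc i) × N → B := fun x => (ψ (0, x) (Fin.last k) : B) + (x.2 : B)
  have hη : ContinuousAt η 0 := by
    have h1 : ContinuousAt (fun x : (∀ i, Nc i) × N => e.symm ((0 : 𝕜), x)) 0 :=
      ContinuousAt.comp (g := e.symm) (f := fun x : (∀ i, Nc i) × N => ((0 : 𝕜), x))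
        (e.continuousAt_symm h0t) (by fun_prop)
    have h2 : ContinuousAt (fun x : (∀ i, Nc i) × N => ψ (0, x) (Fin.last k)) 0 :=
      (continuous_apply (Fin.last k)).continuousAt.comp
        (continuous_fst.continuousAt.comp (continuous_snd.continuousAt.comp h1))
    exact (continuous_subtype_val.continuousAt.comp h2).add
      (continuous_subtype_val.comp continuous_snd).continuousAt
  have hη0 : η 0 = 0 := by
    have : ψ (0, 0) = 0 := congrArg (fun t => t.2.1) h0s
    simp [η, this]
  -- the choice of the radii
  have hρ₂ : {x | η x ∈ O} ∈ 𝓝 (0 : (∀ i, Nc i) × N) := hη (by rwa [hη0])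
  obtain ⟨ρ₂, hρ₂, hρ₂O⟩ := Metric.mem_nhds_iff.mp hρ₂
  obtain ⟨ρ₃, hρ₃, hρ₃t⟩ := Metric.mem_nhds_iff.mp (e.open_target.mem_nhds h0t)
  -- The first condition yields `ψ (ε, 0) = 0` and puts `z ε` into the target, the second makes the
  -- rescaling invertible.
  have hδ₁ : {ε : 𝕜 | (ε, (0 : (∀ i, Nc i) × N)) ∈ e.source ∧ IsUnit (polyCurve p ε)} ∈
      𝓝 (0 : 𝕜) := by
    refine inter_mem (ContinuousAt.preimage_mem_nhds (by fun_prop)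
      (e.open_source.mem_nhds h0e)) ?_
    refine (contDiff_polyCurve (n := 0) p).continuous.continuousAt.preimage_mem_nhds
      (Units.isOpen.mem_nhds ?_)
    rw [polyCurve_zero, hp.coeff_zero]
    exact isUnit_one
  obtain ⟨δ₁, hδ₁, hδ₁e⟩ := Metric.mem_nhds_iff.mp hδ₁
  let δ := min ρ₃ (min δ₀ δ₁)
  let ρ := min ρ₁ (min ρ₂ ρ₃)
  have hδ : 0 < δ := lt_min hρ₃ (lt_min hδ₀ hδ₁)
  have hρ : 0 < ρ := lt_min hρ₁ (lt_min hρ₂ hρ₃)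
  have hball₀ : ball (0 : 𝕜) δ ⊆ ball 0 δ₀ :=
    ball_subset_ball ((min_le_right _ _).trans (min_le_left _ _))
  have hball₁ : ball (0 : 𝕜) δ ⊆ ball 0 δ₁ :=
    ball_subset_ball ((min_le_right _ _).trans (min_le_right _ _))
  have htarget : ball (0 : 𝕜) δ ×ˢ ball (0 : (∀ i, Nc i) × N) ρ ⊆ e.target := by
    refine Set.Subset.trans ?_
      ((ball_prod_same (0 : 𝕜) (0 : (∀ i, Nc i) × N) ρ₃).subset.trans hρ₃t)
    exact Set.prod_mono (ball_subset_ball (min_le_left _ _))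
      (ball_subset_ball ((min_le_right _ _).trans (min_le_right _ _)))
  have hψs : ContDiffOn 𝕜 m ψ (ball (0 : 𝕜) δ ×ˢ ball (0 : (∀ i, Nc i) × N) ρ) :=
    contDiff_fst.comp_contDiffOn (contDiff_snd.comp_contDiffOn (hesm.mono htarget))
  have hψ0 : ∀ ε ∈ ball (0 : 𝕜) δ, ψ (ε, 0) = 0 := by
    intro ε hε
    have h1 := e.left_inv (hδ₁e (hball₁ hε)).1
    rw [hef, hf0] at h1
    exact congrArg (fun t => t.2.1) h1
  have hlin : ∀ ε ∈ ball (0 : 𝕜) δ, ∀ x ∈ ball (0 : (∀ i, Nc i) × N) ρ,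
      G (coneMap z p ψ ε x) = G (z ε) + ε ^ (2 * k) • opSum S x.1 := by
    intro ε hε x hx
    have h1 := hhG ε (hball₀ hε) (ψ (ε, x), x.2)
    rw [(hψ (ε, x) (htarget ⟨hε, hx⟩)).2] at h1
    exact h1
  refine ⟨δ, hδ, ρ, hρ, hball₀.trans hδ₀U, ψ, hψs, hψ0, hlin, ⟨χ, fun i => (hχ i).mono
    (ball_subset_ball (min_le_left _ _)), fun x hx i => ?_⟩, fun ε hε hε0 => ?_⟩
  · have h1 := (hψ (0, x) (htarget ⟨mem_ball_self hδ, hx⟩)).2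
    rw [hhq] at h1
    have h2 : ∀ i, ψ (0, x) i + Sig.symm (q (η x) (η x) (η x)) i = x.1 i := fun i =>
      congrFun h1 i
    have hw : ((x.2, x.1 (Fin.last k)) : N × Nc (Fin.last k)) ∈ ball 0 ρ₁ := by
      have h3 : ‖x‖ < ρ₁ := (mem_ball_zero_iff.mp hx).trans_le (min_le_left _ _)
      rw [mem_ball_zero_iff]
      exact max_lt ((norm_snd_le x).trans_lt h3)
        (((norm_le_pi_norm x.1 _).trans (norm_fst_le x)).trans_lt h3)
    have hη₁ : η x ∈ O :=
      hρ₂O (ball_subset_ball ((min_le_right _ _).trans (min_le_left _ _)) hx)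
    have h4 := hχO (η x) hη₁ _ hw (by
      change η x + ((Sig.symm (q (η x) (η x) (η x)) (Fin.last k) : Nc (Fin.last k)) : B) =
        (x.1 (Fin.last k) : B) + (x.2 : B)
      rw [← h2 (Fin.last k)]
      simp only [η, Submodule.coe_add]
      abel) i
    rw [← h4, ← h2 i]
    simp
  · obtain ⟨T, hT⟩ := exists_cone_equiv D hD hε0 (hδ₁e (hball₁ hε)).2
    have hcone : ∀ x, coneMap z p ψ ε x = z ε + T (ψ (ε, x), x.2) := fun x => by
      rw [hT]; rfl
    let j : B → 𝕜 × ((∀ i, Nc i) × N) := fun b => (ε, T.symm (b - z ε))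
    have hj : ContDiff 𝕜 m j :=
      contDiff_const.prodMk (T.symm.contDiff.comp (contDiff_id.sub contDiff_const))
    have hjc : ∀ x, j (coneMap z p ψ ε x) = (ε, (ψ (ε, x), x.2)) := fun x => by
      simp [j, hcone]
    have hjinv : ∀ b, z ε + T (j b).2 = b := fun b => by simp [j]
    -- Defined as a preimage, the target is open; the two inverse relations show that it is the
    -- image of the ball.
    let W : Set B := j ⁻¹' (e.source ∩ e ⁻¹' (Prod.snd ⁻¹' ball (0 : (∀ i, Nc i) × N) ρ))
    have hW : IsOpen W :=
      (e.isOpen_inter_preimage (isOpen_ball.preimage continuous_snd)).preimage hj.continuous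
    have hmem : ∀ x ∈ ball (0 : (∀ i, Nc i) × N) ρ, (ε, (ψ (ε, x), x.2)) ∈ e.source ∧
        e (ε, (ψ (ε, x), x.2)) = (ε, x) := by
      intro x hx
      have hx' : (ε, x) ∈ e.target := htarget ⟨hε, hx⟩
      have h1 := (hψ (ε, x) hx').1
      have h2 := e.map_target hx'
      have h3 := e.right_inv hx'
      rw [h1] at h2 h3
      exact ⟨h2, h3⟩
    have hinv : ∀ b ∈ W, coneMap z p ψ ε (e (j b)).2 = b := by
      intro b hb
      have h1 := e.left_inv hb.1
      have h2 : e (j b) = (ε, (e (j b)).2) := by rw [hef]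
      conv_rhs => rw [← hjinv b]
      rw [hcone]
      congr 2
      change ((e.symm (ε, (e (j b)).2)).2.1, (e (j b)).2.2) = (j b).2
      rw [← h2, h1, hef]
    have hconec : ContDiffOn 𝕜 m (coneMap z p ψ ε) (ball 0 ρ) := by
      rw [show coneMap z p ψ ε = _ from funext hcone]
      refine contDiffOn_const.add (T.contDiff.comp_contDiffOn (ContDiffOn.prodMk ?_
        contDiff_snd.contDiffOn))
      exact hψs.comp (contDiff_const.prodMk contDiff_id).contDiffOn fun x hx => ⟨hε, hx⟩
    have hsymmc : ContDiffOn 𝕜 m (fun b => (e (j b)).2) W := by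
      refine contDiff_snd.comp_contDiffOn ?_
      simp only [hef]
      exact hf.comp hj.contDiffOn fun b hb => hes hb.1
    let Φ : OpenPartialHomeomorph ((∀ i, Nc i) × N) B :=
      { toFun := coneMap z p ψ ε
        invFun := fun b => (e (j b)).2
        source := ball 0 ρ
        target := W
        map_source' := fun x hx => by
          obtain ⟨h1, h2⟩ := hmem x hx
          simp only [W, Set.mem_preimage, Set.mem_inter_iff, hjc, h2]
          exact ⟨h1, hx⟩
        map_target' := fun b hb => hb.2
        left_inv' := fun x hx => by rw [hjc, (hmem x hx).2]
        right_inv' := hinv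
        open_source := isOpen_ball
        open_target := hW
        continuousOn_toFun := hconec.continuousOn
        continuousOn_invFun := hsymmc.continuousOn }
    refine ⟨Φ, rfl, fun x _ => rfl, ?_, hconec, hsymmc, fun φ hφ => ?_⟩
    · have h1 : j (z ε) = (ε, 0) := by simp [j]
      change z ε ∈ W
      simp only [W, Set.mem_preimage, Set.mem_inter_iff, h1]
      refine ⟨(hδ₁e (hball₁ hε)).1, ?_⟩
      rw [hef, hf0]
      exact mem_ball_self hρ
    · ext b
      constructor
      · rintro ⟨hb, hGb⟩
        have hx : (Φ.symm b) ∈ ball (0 : (∀ i, Nc i) × N) ρ := Φ.map_target hb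
        have hbx : coneMap z p ψ ε (Φ.symm b) = b := Φ.right_inv hb
        have h1 := hlin ε hε _ hx
        rw [hbx, hGb] at h1
        have h2 := smul_right_injective B' (pow_ne_zero (2 * k) hε0) (add_left_cancel h1)
        rw [← hSig, ← hSig] at h2
        have h3 : φ = (Φ.symm b).1 := Sig.injective h2
        refine ⟨(Φ.symm b).2, ?_, ?_⟩
        · exact mem_ball_zero_iff.mpr ((norm_snd_le _).trans_lt (mem_ball_zero_iff.mp hx))
        · rw [h3]
          exact hbx
      · rintro ⟨n, hn, rfl⟩
        have hx : ((φ, n) : (∀ i, Nc i) × N) ∈ ball 0 ρ := by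
          rw [mem_ball_zero_iff] at hφ hn ⊢
          exact max_lt hφ hn
        exact ⟨Φ.map_source hx, hlin ε hε _ hx⟩

theorem theorem1 {𝕜 : Type*} [RCLike 𝕜]
    {B : Type*} [NormedAddCommGroup B] [NormedSpace 𝕜 B] [CompleteSpace B]
    {B' : Type*} [NormedAddCommGroup B'] [NormedSpace 𝕜 B'] [CompleteSpace B']
    (k : ℕ) (r m : ℕ∞) (hm : 1 ≤ m) (hr : m + k + 2 ≤ r)
    (G : B → B') (hG : ContDiff 𝕜 r G)
    (U : Set 𝕜) (hU : IsOpen U) (h0U : (0 : 𝕜) ∈ U)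
    (z : 𝕜 → B) (hz : ContDiffOn 𝕜 r z U) (hz0 : z 0 = 0)
    (L : 𝕜 → B →L[𝕜] B') (hL : ∀ ε, L ε = fderiv 𝕜 G (z ε))
    (hk : IsKSurjective L k)
    (Nc : Fin (k + 1) → Submodule 𝕜 B) (N : Submodule 𝕜 B)
    (R : Fin (k + 1) → Submodule 𝕜 B')
    (hdec : IsJordanDecomposition L k Nc N R) :
    -- the operators and the Jordan chain polynomial exist
    (∃ (S : ∀ i, Nc i ≃L[𝕜] R i) (p : Fin (k + 1) → B →L[𝕜] B),
      IsJordanPolynomial L Nc N R S p) ∧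
    -- and for every choice of them:
    ∀ (S : ∀ i, Nc i ≃L[𝕜] R i) (p : Fin (k + 1) → B →L[𝕜] B),
      IsJordanPolynomial L Nc N R S p →
      ∃ δ > 0, ∃ ρ > 0, ball (0 : 𝕜) δ ⊆ U ∧
      ∃ ψ : 𝕜 × ((∀ i, Nc i) × N) → ∀ i, Nc i,
        -- (i) smoothness, preservation of the origin, linearization
        ContDiffOn 𝕜 m ψ (ball (0 : 𝕜) δ ×ˢ ball (0 : (∀ i, Nc i) × N) ρ) ∧
        (∀ ε ∈ ball (0 : 𝕜) δ, ψ (ε, 0) = 0) ∧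
        (∀ ε ∈ ball (0 : 𝕜) δ, ∀ x ∈ ball (0 : (∀ i, Nc i) × N) ρ,
          G (coneMap z p ψ ε x) = G (z ε) + ε ^ (2 * k) • opSum S x.1) ∧
        -- (i) the near identity relation at `ε = 0`
        (∃ χ : ∀ i, N × Nc (Fin.last k) →
            (N × Nc (Fin.last k)) →L[𝕜] (N × Nc (Fin.last k)) →L[𝕜] Nc i,
          (∀ i, ContDiffOn 𝕜 m (χ i) (ball 0 ρ)) ∧
          ∀ x ∈ ball (0 : (∀ i, Nc i) × N) ρ, ∀ i,
            ψ (0, x) i = x.1 i +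
              χ i (x.2, x.1 (Fin.last k)) (x.2, x.1 (Fin.last k)) (x.2, x.1 (Fin.last k))) ∧
        -- (ii) diffeomorphism onto a neighbourhood of `z ε`, and the level sets in it
        ∀ ε ∈ ball (0 : 𝕜) δ, ε ≠ 0 →
          ∃ Φ : OpenPartialHomeomorph ((∀ i, Nc i) × N) B,
            Φ.source = ball 0 ρ ∧
            Set.EqOn Φ (coneMap z p ψ ε) (ball 0 ρ) ∧
            z ε ∈ Φ.target ∧
            ContDiffOn 𝕜 m Φ Φ.source ∧
            ContDiffOn 𝕜 m Φ.symm Φ.target ∧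
            ∀ φ ∈ ball (0 : ∀ i, Nc i) ρ,
              {b ∈ Φ.target | G b = G (z ε) + ε ^ (2 * k) • opSum S φ} =
                (fun n : N => coneMap z p ψ ε (φ, n)) '' ball (0 : N) ρ := by
  have hr' : ((m : WithTop ℕ∞) + k + 2) ≤ r := by
    have : ((m + k + 2 : ℕ∞) : WithTop ℕ∞) ≤ r := WithTop.coe_le_coe.mpr hr
    exact this
  have hG' := hG.of_le hr'
  have hz' := hz.of_le hr'
  refine ⟨?_, fun S p hp => hp.exists_linearization hm hG' hU h0U hz' hz0 hL hdec⟩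
  obtain ⟨δ, hδ, hδU⟩ := Metric.isOpen_iff.mp hU 0 h0U
  -- For the chains a merely continuous remainder factor suffices, hence the smoothness `0` beyond
  -- order `k + 1`.
  have hLs : ContDiffOn 𝕜 ((0 : ℕ∞) + (k + 1 : ℕ)) L (ball 0 δ) := by
    have h1 : ContDiff 𝕜 ((0 : ℕ∞) + (k + 1 : ℕ)) (fderiv 𝕜 G) := by
      refine hG'.fderiv_right ?_
      have : ((0 : ℕ∞) + (k + 1 : ℕ)) + 1 ≤ m + k + 2 := by
        push_cast
        rw [zero_add, add_assoc, one_add_one_eq_two, add_assoc]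
        exact le_add_self
      exact WithTop.coe_le_coe.mpr this
    refine (h1.comp_contDiffOn ((hz'.mono hδU).of_le ?_)).congr fun ε _ => hL ε
    have : ((0 : ℕ∞) + (k + 1 : ℕ)) ≤ m + k + 2 := by
      push_cast
      rw [zero_add, add_assoc]
      exact le_add_left (by gcongr; exact one_le_two)
    exact WithTop.coe_le_coe.mpr this
  obtain ⟨A, g, hg, hA⟩ := exists_contDiffOn_taylor (k + 1) hLs
  refine hdec.exists_isJordanPolynomial hk (A := A) ?_
  refine (isBigO_pow_smul_of_continuousAt (le_refl (k + 1))
    (hg.continuousOn.continuousAt (ball_mem_nhds 0 hδ))).congr' ?_ EventuallyEq.rfl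
  filter_upwards [ball_mem_nhds 0 hδ] with ε hε
  rw [hA ε hε]
  abel
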